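/- Let $m\in\mathbb N$. For finitely many variables $\mathbf z=(z_1,\dots,z_s)$ let $\mathbb C\{\mathbf z\}$ be the space of germs at $0$ of holomorphic functions of $\mathbf z$, identified with convergent power series. Its factorial topology is the locally convex topology defined by the norms $$\Big\|\sum_{\mathbf n\in\mathbb N^s} f_{\mathbf n}\mathbf z^{\mathbf n}\Big\|_{k}=\sum_{\mathbf n}|f_{\mathbf n}|\,(\mathbf n!)^{-1/k},\qquad k\in\mathbb N_{>0},\quad \mathbf n!=n_1!\cdots n_s!,$$ and $\mathbb C\{\mathbf z\}^m$ carries the product topology. Let $\mathtt{VF}=\mathbb C\{\mathbf z\}^m$, $\mathbf z=(z_1,\dots,z_m)$, be the space of germs at $0\in\mathbb C^m$ of holomorphic vector fields, and let $\mathbb C\{\mathbf z,t\}^m$ be the space of germs at $(0,0)$ of holomorphic maps $\mathbb C^m\times\mathbb C\to\mathbb C^m$, both with the factorial topology. For every $X\in\mathtt{VF}$ there is a unique germ $\Phi_X\in\mathbb C\{\mathbf z,t\}^m$ (the flow of $X$) such that, for $(\mathbf p,t)$ near $(0,0)$, $$\frac{\partial \Phi_X}{\partial t}(\mathbf p,t)=X(\Phi_X(\mathbf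 p,t)),\qquad \Phi_X(\mathbf p,0)=\mathbf p.$$ The flow mapping $\Phi:\mathtt{VF}\to\mathbb C\{\mathbf z,t\}^m$, $X\mapsto\Phi_X$, is strongly analytic, that is: 1. (ample boundedness) for every $X\in\mathtt{VF}$ and every continuous seminorm $b$ on $\mathbb C\{\mathbf z,t\}^m$ there is a neighbourhood $W$ of $0$ in $\mathtt{VF}$ with $\sup_{h\in W}b(\Phi_{X+h})<\infty$; 2. (quasi-strong analyticity) for every $q\ge1$ and every family $(\chi_{\mathbf x})_{\mathbf x}$ of elements of $\mathtt{VF}$, $\mathbf x$ near $0\in\mathbb C^q$, such that $(\mathbf x,\mathbf z)\mapsto\chi_{\mathbf x}(\mathbf z)$ is holomorphic near $(0,0)$, the map $(\mathbf x,\mathbf p,t)\mapsto\Phi_{\chi_{\mathbf x}}(\mathbf p,t)$ is holomorphic near $(0,0,0)$. Moreover $\Phi$ is analytic: for every $X\in\mathtt{VF}$ there are continuous symmetric $p$-linear maps $P_p:\mathtt{VF}^p\to\mathbb C\{\mathbf z,t\}^m$, $p\in\mathbb N$, such that for every continuous seminorm $b$ on $\mathbb C\{\mathbf z,t\}^m$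 there is a neighbourhood $W$ of $0$ in $\mathtt{VF}$ with $b\big(\Phi_{X+h}-\sum_{p=0}^N P_p(h,\dots,h)\big)\to0$ as $N\to\infty$, uniformly for $h\in W$. -/

import Mathlib

open Filter Topology

noncomputable section

namespace FlowGerm

/-- The convergent power series in the (finitely many) variables indexed by `σ`, i.e. those which
converge absolutely on some polydisc of positive radius, as a subspace of the formal ones. -/
def convergentSubmodule (σ : Type) [Fintype σ] : Submodule ℂ (MvPowerSeries σ ℂ) where
  carrier := {f | ∃ r : ℝ, 0 < r ∧
    Summable fun n : σ →₀ ℕ => ‖MvPowerSeries.coeff n f‖ * r ^ (∑ i, n i)}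
  zero_mem' := ⟨1, one_pos, by simp⟩
  add_mem' := by
    rintro f g ⟨r, hr, hf⟩ ⟨s, hs, hg⟩
    refine ⟨min r s, lt_min hr hs, Summable.of_nonneg_of_le (fun n => by positivity)
      (fun n => ?_) (hf.add hg)⟩
    have h0 : 0 ≤ min r s := (lt_min hr hs).le
    have h1 : min r s ^ (∑ i, n i) ≤ r ^ (∑ i, n i) := pow_le_pow_left₀ h0 (min_le_left _ _) _
    have h2 : min r s ^ (∑ i, n i) ≤ s ^ (∑ i, n i) := pow_le_pow_left₀ h0 (min_le_right _ _) _
    calc ‖MvPowerSeries.coeff n (f + g)‖ * min r s ^ (∑ i, n i)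
        ≤ (‖MvPowerSeries.coeff n f‖ + ‖MvPowerSeries.coeff n g‖) * min r s ^ (∑ i, n i) := by
          rw [map_add]
          exact mul_le_mul_of_nonneg_right (norm_add_le _ _) (pow_nonneg h0 _)
      _ ≤ _ := by
          rw [add_mul]
          exact add_le_add (mul_le_mul_of_nonneg_left h1 (norm_nonneg _))
            (mul_le_mul_of_nonneg_left h2 (norm_nonneg _))
  smul_mem' := by
    rintro c f ⟨r, hr, hf⟩
    refine ⟨r, hr, (hf.mul_left ‖c‖).congr fun n => ?_⟩
    rw [map_smul, norm_smul, mul_assoc]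

/-- The space `ℂ{z}` of germs at `0` of holomorphic functions of the variables `z = (z_i)_{i ∈ σ}`,
identified with the space of convergent power series by Taylor expansion. -/
def HolGerm (σ : Type) [Fintype σ] : Type := convergentSubmodule σ

variable {σ : Type} [Fintype σ]

instance : AddCommGroup (HolGerm σ) := inferInstanceAs (AddCommGroup (convergentSubmodule σ))

instance : Module ℂ (HolGerm σ) := inferInstanceAs (Module ℂ (convergentSubmodule σ))

/-- The Taylor coefficient of a germ at the multi-index `n`, as a linear form. -/
def taylorCoeff (n : σ →₀ ℕ) : HolGerm σ →ₗ[ℂ] ℂ :=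
  (MvPowerSeries.coeff n).comp (convergentSubmodule σ).subtype

/-- The value of a germ at a point `z`, the sum of its Taylor series. The series converges
absolutely for all `z` close enough to `0`. -/
def HolGerm.eval (f : HolGerm σ) (z : σ → ℂ) : ℂ :=
  ∑' n : σ →₀ ℕ, taylorCoeff n f * ∏ i, z i ^ n i

/-- The value of a vector of germs at a point. -/
def evalVec {m : ℕ} (f : Fin m → HolGerm σ) (z : σ → ℂ) : Fin m → ℂ :=
  fun i => (f i).eval z

/-! ### The factorial topology -/

/-- The weight `(n!)^(-α)` of the multi-index `n`, where `n! = ∏ i, (n i)!`. -/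
def weight (α : ℝ) (n : σ →₀ ℕ) : ℝ := (∏ i, ((n i).factorial : ℝ)) ^ (-α)

theorem weight_nonneg (α : ℝ) (n : σ →₀ ℕ) : 0 ≤ weight α n := by
  unfold weight; positivity

theorem factorial_rpow_le {α r : ℝ} (hα : 0 < α) (hr : 0 < r) (k : ℕ) :
    (k.factorial : ℝ) ^ (-α) ≤ Real.exp (r ^ (-α⁻¹)) ^ α * r ^ k := by
  have hy : 0 < r ^ (-α⁻¹) := Real.rpow_pos_of_pos hr _
  have hk : (0 : ℝ) < k.factorial := by positivity
  have h1 : (r ^ (-α⁻¹)) ^ k / k.factorial ≤ Real.exp (r ^ (-α⁻¹)) :=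
    Real.pow_div_factorial_le_exp _ hy.le k
  have h2 := Real.rpow_le_rpow (by positivity) h1 hα.le
  have h3 : ((r ^ (-α⁻¹)) ^ k) ^ α = (r ^ k)⁻¹ := by
    rw [← Real.rpow_natCast, ← Real.rpow_mul hr.le, ← Real.rpow_mul hr.le, ← Real.rpow_natCast,
      ← Real.rpow_neg hr.le]
    congr 1
    field_simp
  rw [Real.div_rpow (by positivity) hk.le, h3, div_le_iff₀ (by positivity)] at h2
  rw [Real.rpow_neg hk.le, inv_le_iff_one_le_mul₀ (by positivity)]
  have hrk : 0 < r ^ k := by positivity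
  calc (1 : ℝ) = (r ^ k)⁻¹ * r ^ k := by field_simp
    _ ≤ (Real.exp (r ^ (-α⁻¹)) ^ α * (k.factorial : ℝ) ^ α) * r ^ k :=
        mul_le_mul_of_nonneg_right h2 hrk.le
    _ = _ := by ring

theorem summable_weight {α : ℝ} (hα : 0 < α) (f : HolGerm σ) :
    Summable fun n : σ →₀ ℕ => ‖taylorCoeff n f‖ * weight α n := by
  obtain ⟨r, hr, hf⟩ := f.2
  refine Summable.of_nonneg_of_le (fun n => mul_nonneg (norm_nonneg _) (weight_nonneg α n))
    (fun n => ?_) (hf.mul_left (∏ _i : σ, Real.exp (r ^ (-α⁻¹)) ^ α))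
  have h : weight α n ≤ (∏ _i : σ, Real.exp (r ^ (-α⁻¹)) ^ α) * r ^ (∑ i, n i) := by
    unfold weight
    rw [← Real.finsetProd_rpow _ _ (fun i _ => by positivity), ← Finset.prod_pow_eq_pow_sum,
      ← Finset.prod_mul_distrib]
    exact Finset.prod_le_prod (fun i _ => by positivity)
      (fun i _ => factorial_rpow_le hα hr (n i))
  calc _ ≤ ‖taylorCoeff n f‖ * ((∏ _i : σ, Real.exp (r ^ (-α⁻¹)) ^ α) * r ^ (∑ i, n i)) :=
        mul_le_mul_of_nonneg_left h (norm_nonneg _)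
    _ = _ := by rw [mul_left_comm]; rfl

variable (σ) in
/-- The norms `‖f‖ = ∑ₙ |fₙ| (n!)^(-1/(k+1))`, `k ∈ ℕ`, that define the factorial topology. -/
def factorialNorm : SeminormFamily ℂ (HolGerm σ) ℕ := fun k =>
  Seminorm.of (fun f => ∑' n : σ →₀ ℕ, ‖taylorCoeff n f‖ * weight (1 / ((k : ℝ) + 1)) n)
    (by
      intro f g
      have hk : (0 : ℝ) < 1 / ((k : ℝ) + 1) := by positivity
      have hf := summable_weight hk f
      have hg := summable_weight hk g
      rw [← hf.tsum_add hg]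
      refine (summable_weight hk (f + g)).tsum_le_tsum (fun n => ?_) (hf.add hg)
      rw [map_add, ← add_mul]
      exact mul_le_mul_of_nonneg_right (norm_add_le _ _) (weight_nonneg _ n))
    (by
      intro c f
      rw [← tsum_mul_left]
      refine tsum_congr fun n => ?_
      rw [map_smul, norm_smul, mul_assoc])

/-- The factorial topology on `ℂ{z}`. The spaces `ℂ{z}^m = Fin m → HolGerm σ` carry the product
topology. -/
instance : TopologicalSpace (HolGerm σ) := (factorialNorm σ).moduleFilterBasis.topology

theorem withSeminorms_factorialNorm : WithSeminorms (factorialNorm σ) := ⟨rfl⟩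

/-! ### Ample boundedness and analyticity between locally convex spaces -/

section LocallyConvex

variable {E F : Type*} [AddCommGroup E] [Module ℂ E] [TopologicalSpace E]
  [AddCommGroup F] [Module ℂ F] [TopologicalSpace F]

/-- `Λ` is amply bounded: for each continuous seminorm `b` of the target, `b ∘ Λ` is bounded near
each point. -/
def AmplyBounded (Λ : E → F) : Prop :=
  ∀ f : E, ∀ b : Seminorm ℂ F, Continuous b →
    ∃ W ∈ 𝓝 (0 : E), ∃ C : ℝ, ∀ h ∈ W, b (Λ (f + h)) ≤ C

/-- `Λ` is analytic at `f`: there are continuous symmetric `p`-linear maps `P p` such that, for each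
continuous seminorm `b` of the target, `∑ P p (h, …, h)` converges to `Λ (f + h)` with respect
to `b`, uniformly for `h` in some neighbourhood of `0` (which may depend on `b`). -/
def AnalyticMapAt (Λ : E → F) (f : E) : Prop :=
  ∃ P : (p : ℕ) → ContinuousMultilinearMap ℂ (fun _ : Fin p => E) F,
    (∀ (p : ℕ) (s : Equiv.Perm (Fin p)) (v : Fin p → E), P p (fun i => v (s i)) = P p v) ∧
    ∀ b : Seminorm ℂ F, Continuous b → ∃ W ∈ 𝓝 (0 : E),
      TendstoUniformlyOn
        (fun (N : ℕ) (h : E) => b (Λ (f + h) - ∑ p ∈ Finset.range (N + 1), P p (fun _ => h)))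
        (fun _ => 0) atTop W

/-- `Λ` is analytic on the whole space. -/
def AnalyticMap (Λ : E → F) : Prop := ∀ f : E, AnalyticMapAt Λ f

end LocallyConvex

/-! ### Strong analyticity between spaces of germs -/

/-- `l` defines a germ of a holomorphic map `(ℂ^q, 0) → ℂ{z}^m`: the function
`(x, z) ↦ l(x)(z)` is holomorphic near `(0, 0)`. -/
def IsHolFamily {q m : ℕ} (l : (Fin q → ℂ) → (Fin m → HolGerm σ)) : Prop :=
  AnalyticAt ℂ (fun y : (Fin q → ℂ) × (σ → ℂ) => evalVec (l y.1) y.2) 0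

/-- `Λ` maps each finite-dimensional holomorphic family of germs to a holomorphic family. -/
def QuasiStronglyAnalytic {τ : Type} [Fintype τ] {m k : ℕ}
    (Λ : (Fin m → HolGerm σ) → (Fin k → HolGerm τ)) : Prop :=
  ∀ q : ℕ, 0 < q → ∀ l : (Fin q → ℂ) → (Fin m → HolGerm σ),
    IsHolFamily l → IsHolFamily (fun x => Λ (l x))

/-- `Λ` is strongly analytic: amply bounded and quasi-strongly analytic. -/
def StronglyAnalytic {τ : Type} [Fintype τ] {m k : ℕ}
    (Λ : (Fin m → HolGerm σ) → (Fin k → HolGerm τ)) : Prop :=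
  AmplyBounded Λ ∧ QuasiStronglyAnalytic Λ

/-! ### Flows -/

/-- The space of germs at `0 ∈ ℂ^m` of holomorphic vector fields, identified with `ℂ{z}^m`. -/
abbrev VF (m : ℕ) : Type := Fin m → HolGerm (Fin m)

/-- The space `ℂ{z,t}^m` of germs at `(0, 0)` of holomorphic maps `ℂ^m × ℂ → ℂ^m`. The first `m`
variables are `z`, the last one is the time `t`. -/
abbrev FlowSpace (m : ℕ) : Type := Fin m → HolGerm (Fin m ⊕ Unit)

/-- The value `φ(p, t)`. -/
def flowVal {m : ℕ} (φ : FlowSpace m) (p : Fin m → ℂ) (t : ℂ) : Fin m → ℂ :=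
  evalVec φ (Sum.elim p fun _ => t)

/-- `φ` is a flow germ of `X`: near `(0, 0)` it solves `∂φ/∂t (p, t) = X (φ (p, t))`,
`φ (p, 0) = p`. -/
def IsFlowGerm {m : ℕ} (X : VF m) (φ : FlowSpace m) : Prop :=
  (∀ᶠ y : (Fin m → ℂ) × ℂ in 𝓝 0,
    HasDerivAt (fun s => flowVal φ y.1 s) (evalVec X (flowVal φ y.1 y.2)) y.2) ∧
  ∀ᶠ p : Fin m → ℂ in 𝓝 0, flowVal φ p 0 = p

end FlowGerm

end

/-! The flow is the Lie series: its `i`-th component is the sum of `t ^ n / n!` times `D_X ^ n z_i`,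
where `D_X` is the derivation along `X` (`flowSeries`). So the coefficient at `z ^ j * t ^ n` is the
diagonal of an `n`-linear form in the field, and this form sees only the coefficients of the fields
of degree at most `N = |j| + n`. Everything topological is a bound on these forms (`coeffForm`).

The bound is a Cauchy estimate (`norm_coeff_iterFieldDeriv_le`) on the polydisc of radius `(N + 1) ^
(-β)`, which shrinks with the degree. Because only degrees at most `N` matter, and `l! ≤ (N + 1) ^
|l|` there, the ℓ¹ norm on this polydisc is at most the factorial norm of exponent `β`. This gives
`(2e (N + 1) ^ β) ^ N` times the product of the factorial norms of the fields (`norm_coeffForm_le`).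
Up to a geometric factor, `(N + 1) ^ N` is at most the multi-index factorial, so these bounds are
summable against the weight of any exponent `α > β` (`summable_growth_mul_weight`). Ample
boundedness follows. Expanding the forms at `X + h` over subsets of the slots costs only `2 ^ n`, so
the polarized terms are continuous and the remainders are dominated by the same kind of series,
uniformly in `h`.

Existence and uniqueness use the linear equation `∂_t g = D_X g`, which determines `g` from its
value at `t = 0`. Both `∂_t φ_i` and `X_i ∘ φ` solve it for the Lie series `φ`, with the same
initial value; conversely, for any flow `φ` the chain rule gives `∂_t ^ n φ_i = (D_X ^ n z_i) ∘ φ`.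

For quasi-strong analyticity, the parameters are treated as extra space variables in which the field
vanishes. The flow of the enlarged field is jointly analytic, and uniqueness identifies its slices
with the flows of the members of the family. -/

open scoped ENNReal NNReal

noncomputable section

namespace FlowGerm

/-! ### Truncated weighted ℓ¹ norms of formal power series -/

section FormalNorm

variable {σ : Type}

/-- The weighted `ℓ¹` norm of the part of degree at most `L` of a formal power series. -/
def truncNorm (L : ℕ∞) (s : ℝ≥0∞) (f : MvPowerSeries σ ℂ) : ℝ≥0∞ :=
  ∑' l : σ →₀ ℕ, if (l.degree : ℕ∞) ≤ L then ‖MvPowerSeries.coeff l f‖ₑ * s ^ l.degree else 0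

theorem enorm_coeff_mul_le_truncNorm {L : ℕ∞} {l : σ →₀ ℕ} (hl : (l.degree : ℕ∞) ≤ L) (s : ℝ≥0∞)
    (f : MvPowerSeries σ ℂ) :
    ‖MvPowerSeries.coeff l f‖ₑ * s ^ l.degree ≤ truncNorm L s f := by
  refine le_trans (by rw [if_pos hl]) (ENNReal.le_tsum l)

theorem truncNorm_mono {L L' : ℕ∞} {s s' : ℝ≥0∞} (hL : L ≤ L') (hs : s ≤ s')
    (f : MvPowerSeries σ ℂ) : truncNorm L s f ≤ truncNorm L' s' f := by
  refine ENNReal.tsum_le_tsum fun l => ?_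
  by_cases h : (l.degree : ℕ∞) ≤ L
  · rw [if_pos h, if_pos (h.trans hL)]
    gcongr
  · rw [if_neg h]
    exact zero_le

@[simp]
theorem truncNorm_zero (L : ℕ∞) (s : ℝ≥0∞) : truncNorm L s (0 : MvPowerSeries σ ℂ) = 0 := by
  simp [truncNorm]

theorem truncNorm_add_le (L : ℕ∞) (s : ℝ≥0∞) (f g : MvPowerSeries σ ℂ) :
    truncNorm L s (f + g) ≤ truncNorm L s f + truncNorm L s g := by
  unfold truncNorm
  rw [← ENNReal.tsum_add]
  refine ENNReal.tsum_le_tsum fun l => ?_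
  by_cases h : (l.degree : ℕ∞) ≤ L
  · simp only [if_pos h, map_add, ← add_mul]
    gcongr
    exact enorm_add_le _ _
  · simp [if_neg h]

theorem truncNorm_sum_le {ι : Type*} (L : ℕ∞) (s : ℝ≥0∞) (t : Finset ι)
    (f : ι → MvPowerSeries σ ℂ) :
    truncNorm L s (∑ i ∈ t, f i) ≤ ∑ i ∈ t, truncNorm L s (f i) := by
  classical
  induction t using Finset.induction_on with
  | empty => simp
  | insert a t ha ih =>
    rw [Finset.sum_insert ha, Finset.sum_insert ha]
    exact (truncNorm_add_le _ _ _ _).trans (add_le_add le_rfl ih)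

/-- A monomial of degree at most `L` in a product comes only from pairs of monomials of degree at
most `L`, so truncation does not spoil the usual Cauchy product estimate. -/
theorem truncNorm_mul_le (L : ℕ∞) (s : ℝ≥0∞) (f g : MvPowerSeries σ ℂ) :
    truncNorm L s (f * g) ≤ truncNorm L s f * truncNorm L s g := by
  classical
  have key : ∀ l : σ →₀ ℕ,
      (if (l.degree : ℕ∞) ≤ L then ‖MvPowerSeries.coeff l (f * g)‖ₑ * s ^ l.degree else 0) ≤
      ∑ p ∈ Finset.HasAntidiagonal.antidiagonal l,
        (if (p.1.degree : ℕ∞) ≤ L then ‖MvPowerSeries.coeff p.1 f‖ₑ * s ^ p.1.degree else 0) *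
        (if (p.2.degree : ℕ∞) ≤ L then ‖MvPowerSeries.coeff p.2 g‖ₑ * s ^ p.2.degree else 0) := by
    intro l
    split_ifs with h
    · rw [MvPowerSeries.coeff_mul]
      refine (mul_le_mul_left (enorm_sum_le _ _) _).trans ?_
      rw [Finset.sum_mul]
      refine Finset.sum_le_sum fun p hp => ?_
      have hp' : p.1 + p.2 = l := Finset.HasAntidiagonal.mem_antidiagonal.1 hp
      have hd : p.1.degree + p.2.degree = l.degree := by rw [← hp', map_add]
      have h1 : (p.1.degree : ℕ∞) ≤ L := le_trans (by exact_mod_cast (by omega)) h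
      have h2 : (p.2.degree : ℕ∞) ≤ L := le_trans (by exact_mod_cast (by omega)) h
      rw [if_pos h1, if_pos h2, ← hd, pow_add, enorm_mul]
      exact le_of_eq (by ring)
    · exact zero_le
  refine (ENNReal.tsum_le_tsum key).trans ?_
  unfold truncNorm
  rw [← ENNReal.tsum_mul_right]
  simp_rw [← ENNReal.tsum_mul_left]
  rw [← ENNReal.tsum_prod, ← Finset.HasAntidiagonal.sigmaAntidiagonalEquivProd.tsum_eq,
    ENNReal.tsum_sigma']
  refine le_of_eq (tsum_congr fun l => ?_)
  rw [tsum_fintype, ← Finset.sum_coe_sort]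
  rfl

/-- The left side is a single term of the binomial expansion of the right side. -/
theorem succ_mul_pow_mul_le (a d : ℝ≥0∞) (k : ℕ) :
    ((k : ℝ≥0∞) + 1) * a ^ k * d ≤ (a + d) ^ (k + 1) := by
  induction k with
  | zero => simp
  | succ k ih =>
    have h1 : a ^ (k + 1) ≤ (a + d) ^ (k + 1) := by gcongr; exact le_self_add
    calc ((k + 1 : ℕ) + 1 : ℝ≥0∞) * a ^ (k + 1) * d
        = a * (((k : ℝ≥0∞) + 1) * a ^ k * d) + d * a ^ (k + 1) := by push_cast; ring
      _ ≤ a * (a + d) ^ (k + 1) + d * (a + d) ^ (k + 1) := by gcongr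
      _ = (a + d) ^ (k + 1 + 1) := by ring

/-- The price of a derivative is one more degree and a radius larger by `d`. The factor `l i + 1`
that differentiation produces is absorbed by `succ_mul_pow_mul_le`. -/
theorem mul_truncNorm_pderiv_le (L : ℕ∞) (s d : ℝ≥0∞) (i : σ) (f : MvPowerSeries σ ℂ) :
    d * truncNorm L s (MvPowerSeries.pderiv ℂ i f) ≤ truncNorm (L + 1) (s + d) f := by
  unfold truncNorm
  rw [← ENNReal.tsum_mul_left]
  refine le_trans (ENNReal.tsum_le_tsum fun l => ?_) (ENNReal.tsum_comp_le_tsum_of_injective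
    (f := fun l : σ →₀ ℕ => l + Finsupp.single i 1) (add_left_injective _) _)
  by_cases h : (l.degree : ℕ∞) ≤ L
  · have h' : (((l + Finsupp.single i 1).degree : ℕ) : ℕ∞) ≤ L + 1 := by
      rw [map_add, Finsupp.degree_single]
      push_cast
      gcongr
    simp only [if_pos h, if_pos h']
    rw [MvPowerSeries.coeff_pderiv, enorm_mul, map_add, Finsupp.degree_single]
    have h1 : ‖((l i : ℂ) + 1)‖ₑ ≤ (l.degree : ℝ≥0∞) + 1 := by
      have : ((l i : ℂ) + 1) = ((l i + 1 : ℕ) : ℂ) := by push_cast; rfl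
      rw [this, ← ofReal_norm, Complex.norm_natCast, ENNReal.ofReal_natCast]
      have := Finsupp.le_degree i l
      push_cast
      gcongr
    calc _ ≤ d * (‖MvPowerSeries.coeff (l + Finsupp.single i 1) f‖ₑ * ((l.degree : ℝ≥0∞) + 1) *
          s ^ l.degree) := by gcongr
      _ = ‖MvPowerSeries.coeff (l + Finsupp.single i 1) f‖ₑ *
          (((l.degree : ℝ≥0∞) + 1) * s ^ l.degree * d) := by ring
      _ ≤ _ := by gcongr; exact succ_mul_pow_mul_le _ _ _
  · simp [if_neg h]

theorem truncNorm_X_le (L : ℕ∞) (s : ℝ≥0∞) (i : σ) :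
    truncNorm L s (MvPowerSeries.X i : MvPowerSeries σ ℂ) ≤ s := by
  classical
  unfold truncNorm
  rw [tsum_eq_single (Finsupp.single i 1)]
  · rw [MvPowerSeries.coeff_X, if_pos rfl]
    split_ifs <;> simp
  · intro l hl
    rw [MvPowerSeries.coeff_X, if_neg hl]
    simp

end FormalNorm

/-! ### Derivations along formal vector fields and their Cauchy estimates -/

section FieldDeriv

variable {σ : Type} [Fintype σ]

/-- The derivation `f ↦ ∑ i, Y i * ∂f/∂z_i` defined by a formal vector field `Y`. -/
def fieldDeriv : (σ → MvPowerSeries σ ℂ) →ₗ[ℂ] Module.End ℂ (MvPowerSeries σ ℂ) :=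
  LinearMap.mk₂ ℂ (fun Y f => ∑ i, Y i * MvPowerSeries.pderiv ℂ i f)
    (fun Y Z f => by simp [add_mul, Finset.sum_add_distrib])
    (fun c Y f => by simp [Finset.smul_sum])
    (fun Y f g => by simp [mul_add, Finset.sum_add_distrib])
    (fun c Y f => by simp [Finset.smul_sum])

theorem fieldDeriv_apply (Y : σ → MvPowerSeries σ ℂ) (f : MvPowerSeries σ ℂ) :
    fieldDeriv Y f = ∑ i, Y i * MvPowerSeries.pderiv ℂ i f := rfl

/-- The iterated derivative `D_{Y_0} ⋯ D_{Y_{n-1}} f` as a multilinear map of the fields. -/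
def iterFieldDeriv (n : ℕ) (f : MvPowerSeries σ ℂ) :
    MultilinearMap ℂ (fun _ : Fin n => σ → MvPowerSeries σ ℂ) (MvPowerSeries σ ℂ) :=
  ((LinearMap.applyₗ f).compMultilinearMap
    (MultilinearMap.mkPiAlgebraFin ℂ n (Module.End ℂ (MvPowerSeries σ ℂ)))).compLinearMap
      (fun _ => fieldDeriv)

theorem iterFieldDeriv_apply (n : ℕ) (f : MvPowerSeries σ ℂ) (Y : Fin n → σ → MvPowerSeries σ ℂ) :
    iterFieldDeriv n f Y = (List.ofFn fun k => fieldDeriv (Y k)).prod f := rfl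

theorem iterFieldDeriv_const (n : ℕ) (f : MvPowerSeries σ ℂ) (Y : σ → MvPowerSeries σ ℂ) :
    iterFieldDeriv n f (fun _ => Y) = (fieldDeriv Y ^ n) f := by
  rw [iterFieldDeriv_apply, List.ofFn_const, List.prod_replicate]

theorem mul_truncNorm_fieldDeriv_le (L : ℕ∞) (s d : ℝ≥0∞) (Y : σ → MvPowerSeries σ ℂ)
    (f : MvPowerSeries σ ℂ) :
    d * truncNorm L s (fieldDeriv Y f) ≤ (∑ i, truncNorm L s (Y i)) * truncNorm (L + 1) (s + d) f := by
  rw [fieldDeriv_apply, Finset.sum_mul]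
  refine (mul_le_mul_right (truncNorm_sum_le _ _ _ _) _).trans ?_
  rw [Finset.mul_sum]
  refine Finset.sum_le_sum fun i _ => ?_
  calc _ ≤ d * (truncNorm L s (Y i) * truncNorm L s (MvPowerSeries.pderiv ℂ i f)) := by
        gcongr; exact truncNorm_mul_le _ _ _ _
    _ = truncNorm L s (Y i) * (d * truncNorm L s (MvPowerSeries.pderiv ℂ i f)) := by ring
    _ ≤ _ := by gcongr; exact mul_truncNorm_pderiv_le _ _ _ _ _

/-- Each of the `n` derivations uses up one degree and a portion `d` of the radius. Keeping the
cut-off finite is essential later, when the radius is chosen in terms of the degree. -/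
theorem pow_mul_truncNorm_iterFieldDeriv_le (n : ℕ) (L : ℕ∞) (s d : ℝ≥0∞)
    (f : MvPowerSeries σ ℂ) (Y : Fin n → σ → MvPowerSeries σ ℂ) :
    d ^ n * truncNorm L s (iterFieldDeriv n f Y) ≤
      (∏ k, ∑ i, truncNorm (L + n) (s + n * d) (Y k i)) * truncNorm (L + n) (s + n * d) f := by
  induction n generalizing L s with
  | zero => simp [iterFieldDeriv_apply]
  | succ n ih =>
    have h0 : iterFieldDeriv (n + 1) f Y =
        fieldDeriv (Y 0) (iterFieldDeriv n f fun k => Y k.succ) := by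
      rw [iterFieldDeriv_apply, iterFieldDeriv_apply, List.ofFn_succ, List.prod_cons]
      rfl
    have hL : L + 1 + (n : ℕ∞) = L + ((n + 1 : ℕ) : ℕ∞) := by push_cast; ring
    have hs : s + d + n * d = s + ((n + 1 : ℕ) : ℝ≥0∞) * d := by push_cast; ring
    have ih' := ih (L + 1) (s + d) (fun k => Y k.succ)
    rw [hL, hs] at ih'
    rw [h0, Fin.prod_univ_succ]
    calc d ^ (n + 1) * truncNorm L s (fieldDeriv (Y 0) (iterFieldDeriv n f fun k => Y k.succ))
        = d ^ n * (d * truncNorm L s (fieldDeriv (Y 0) (iterFieldDeriv n f fun k => Y k.succ))) := by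
          ring
      _ ≤ d ^ n * ((∑ i, truncNorm L s (Y 0 i)) *
            truncNorm (L + 1) (s + d) (iterFieldDeriv n f fun k => Y k.succ)) := by
          exact mul_le_mul_right (mul_truncNorm_fieldDeriv_le L s d (Y 0) _) _
      _ = (∑ i, truncNorm L s (Y 0 i)) *
            (d ^ n * truncNorm (L + 1) (s + d) (iterFieldDeriv n f fun k => Y k.succ)) := by ring
      _ ≤ (∑ i, truncNorm (L + (n + 1 : ℕ)) (s + (n + 1 : ℕ) * d) (Y 0 i)) *
          ((∏ k : Fin n, ∑ i, truncNorm (L + (n + 1 : ℕ)) (s + (n + 1 : ℕ) * d) (Y k.succ i)) *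
            truncNorm (L + (n + 1 : ℕ)) (s + (n + 1 : ℕ) * d) f) := by
          refine mul_le_mul' (Finset.sum_le_sum fun i _ => ?_) ih'
          exact truncNorm_mono le_self_add le_self_add _
      _ = _ := by ring

/-- Cauchy-type estimate for the coefficients of the iterated derivatives of a coordinate. -/
theorem norm_coeff_iterFieldDeriv_le {n : ℕ} (j : σ →₀ ℕ) (i : σ)
    (Y : Fin n → σ → MvPowerSeries σ ℂ) {r : ℝ} (hr : 0 < r) {B : Fin n → ℝ} (hB : ∀ k, 0 ≤ B k)
    (hY : ∀ k, ∑ i, truncNorm (j.degree + n : ℕ) (ENNReal.ofReal (2 * r)) (Y k i) ≤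
      ENNReal.ofReal (B k)) :
    ‖MvPowerSeries.coeff j (iterFieldDeriv n (MvPowerSeries.X i) Y)‖ / n.factorial ≤
      (1 / r) ^ j.degree * (Real.exp 1 / r) ^ n * (2 * r) * ∏ k, B k := by
  -- The extra radius `r` is divided evenly among the `n` derivations: `s = r`, `d = r / n`. For `n
  -- = 0` the quotient is `0`, which is harmless since it occurs to the power `0` or multiplied by
  -- `n`.
  have key : (r / n) ^ n * (‖MvPowerSeries.coeff j (iterFieldDeriv n (MvPowerSeries.X i) Y)‖ *
      r ^ j.degree) ≤ (∏ k, B k) * (2 * r) := by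
    have hP : 0 ≤ ∏ k, B k := Finset.prod_nonneg fun k _ => hB k
    rw [← ENNReal.ofReal_le_ofReal_iff (by positivity), ENNReal.ofReal_mul (by positivity),
      ENNReal.ofReal_mul (by positivity), ENNReal.ofReal_mul hP,
      ENNReal.ofReal_prod_of_nonneg (fun k _ => hB k), ENNReal.ofReal_pow (by positivity),
      ENNReal.ofReal_pow hr.le, ofReal_norm]
    have h2 : ENNReal.ofReal r + n * ENNReal.ofReal (r / n) ≤ ENNReal.ofReal (2 * r) := by
      rw [← ENNReal.ofReal_natCast, ← ENNReal.ofReal_mul (by positivity),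
        ← ENNReal.ofReal_add hr.le (by positivity)]
      refine ENNReal.ofReal_le_ofReal ?_
      rcases Nat.eq_zero_or_pos n with rfl | hn
      · simp; linarith
      · have : (0 : ℝ) < n := by exact_mod_cast hn
        field_simp
        linarith
    refine (mul_le_mul_right (enorm_coeff_mul_le_truncNorm (L := j.degree) le_rfl _ _) _).trans ?_
    refine (pow_mul_truncNorm_iterFieldDeriv_le _ _ _ _ _ _).trans ?_
    gcongr with k
    · refine le_trans ?_ (hY k)
      gcongr with i
      exact truncNorm_mono (by push_cast; rfl) h2 _
    · exact (truncNorm_X_le _ _ _).trans h2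
  -- This weak form of Stirling's formula lets the division by `n!` absorb the `n ^ n` from the
  -- choice of `d`.
  have hn : ((n : ℝ) ^ n) ≤ Real.exp 1 ^ n * n.factorial := by
    have := Real.pow_div_factorial_le_exp (n : ℝ) (by positivity) n
    rw [div_le_iff₀ (by positivity)] at this
    rwa [← Real.exp_nat_mul, mul_one]
  have hP : 0 ≤ ∏ k, B k := Finset.prod_nonneg fun k _ => hB k
  set c := ‖MvPowerSeries.coeff j (iterFieldDeriv n (MvPowerSeries.X i) Y)‖
  have hnn : (0 : ℝ) < (n : ℝ) ^ n := by
    rcases Nat.eq_zero_or_pos n with rfl | hn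
    · simp
    · positivity
  rw [div_pow, div_mul_eq_mul_div, div_le_iff₀ hnn] at key
  rw [div_le_iff₀ (by positivity)]
  have hc : c = (r ^ n * (c * r ^ j.degree)) * ((1 / r) ^ j.degree * (1 / r) ^ n) := by
    simp only [div_pow, one_pow]
    field_simp
  rw [hc]
  calc _ ≤ ((∏ k, B k) * (2 * r) * (Real.exp 1 ^ n * n.factorial)) *
        ((1 / r) ^ j.degree * (1 / r) ^ n) := by
        refine mul_le_mul_of_nonneg_right (key.trans ?_) (by positivity)
        gcongr
    _ = _ := by simp only [div_pow, one_pow]; ring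

end FieldDeriv

/-! ### Absolute convergence on a polydisc -/

section Radius

variable {σ : Type}

/-- The series `f` converges absolutely on the closed polydisc of radius `r`. -/
def HasRadius (r : ℝ) (f : MvPowerSeries σ ℂ) : Prop :=
  Summable fun l : σ →₀ ℕ => ‖MvPowerSeries.coeff l f‖ * r ^ l.degree

theorem hasRadius_iff_truncNorm_ne_top {r : ℝ} (hr : 0 ≤ r) {f : MvPowerSeries σ ℂ} :
    HasRadius r f ↔ truncNorm ⊤ (ENNReal.ofReal r) f ≠ ⊤ := by
  have h : truncNorm ⊤ (ENNReal.ofReal r) f =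
      ∑' l : σ →₀ ℕ, ENNReal.ofReal (‖MvPowerSeries.coeff l f‖ * r ^ l.degree) := by
    refine tsum_congr fun l => ?_
    rw [if_pos le_top, ENNReal.ofReal_mul (norm_nonneg _), ENNReal.ofReal_pow hr, ofReal_norm]
  rw [h]
  refine ⟨fun hf => hf.tsum_ofReal_ne_top, fun hf => ?_⟩
  refine (ENNReal.summable_toReal hf).congr fun l => ?_
  rw [ENNReal.toReal_ofReal (by positivity)]

theorem HasRadius.mono {r s : ℝ} {f : MvPowerSeries σ ℂ} (hf : HasRadius r f) (hs : 0 ≤ s)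
    (hsr : s ≤ r) : HasRadius s f :=
  Summable.of_nonneg_of_le (fun l => by positivity) (fun l => by gcongr) hf

theorem HasRadius.mul {r : ℝ} (hr : 0 ≤ r) {f g : MvPowerSeries σ ℂ} (hf : HasRadius r f)
    (hg : HasRadius r g) : HasRadius r (f * g) := by
  rw [hasRadius_iff_truncNorm_ne_top hr] at *
  exact ne_top_of_le_ne_top (ENNReal.mul_ne_top hf hg) (truncNorm_mul_le _ _ _ _)

theorem HasRadius.pderiv {r s : ℝ} (hs : 0 ≤ s) (hsr : s < r) {f : MvPowerSeries σ ℂ}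
    (hf : HasRadius r f) (i : σ) : HasRadius s (MvPowerSeries.pderiv ℂ i f) := by
  rw [hasRadius_iff_truncNorm_ne_top (hs.trans hsr.le)] at hf
  rw [hasRadius_iff_truncNorm_ne_top hs]
  have h := mul_truncNorm_pderiv_le ⊤ (ENNReal.ofReal s) (ENNReal.ofReal (r - s)) i f
  rw [← ENNReal.ofReal_add hs (sub_nonneg.2 hsr.le), add_sub_cancel, top_add] at h
  intro htop
  rw [htop, ENNReal.mul_top (by simpa using hsr)] at h
  exact hf (top_le_iff.1 h)

theorem HasRadius.sum {ι : Type*} {r : ℝ} {t : Finset ι} {f : ι → MvPowerSeries σ ℂ}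
    (hr : 0 ≤ r) (hf : ∀ i ∈ t, HasRadius r (f i)) : HasRadius r (∑ i ∈ t, f i) := by
  rw [hasRadius_iff_truncNorm_ne_top hr]
  refine ne_top_of_le_ne_top ?_ (truncNorm_sum_le _ _ _ _)
  exact ENNReal.sum_ne_top.2 fun i hi => (hasRadius_iff_truncNorm_ne_top hr).1 (hf i hi)

theorem hasRadius_X (r : ℝ) (i : σ) : HasRadius r (MvPowerSeries.X i : MvPowerSeries σ ℂ) := by
  classical
  refine summable_of_ne_finset_zero (s := {Finsupp.single i 1}) fun l hl => ?_
  rw [MvPowerSeries.coeff_X, if_neg (by simpa using hl)]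
  simp

theorem hasRadius_of_forall_le {f : MvPowerSeries σ ℂ} {r : ℝ} (hr : 0 < r)
    {g : (σ →₀ ℕ) → ℝ} (hg : Summable g)
    (hf : ∀ l, ‖MvPowerSeries.coeff l f‖ * r ^ l.degree ≤ g l) : HasRadius r f :=
  Summable.of_nonneg_of_le (fun l => by positivity) hf hg

/-- This is the index shift in termwise differentiation. Multi-indices with `l i = 0`, where the
subtraction truncates, carry the factor `0`. -/
theorem hasSum_mul_sub_single_iff {R : Type*} [NormedRing R] (i : σ) (c : (σ →₀ ℕ) → R)
    (m : (σ →₀ ℕ) → R) {a : R} :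
    HasSum (fun l : σ →₀ ℕ => c l * (l i : R) * m (l - Finsupp.single i 1)) a ↔
      HasSum (fun l : σ →₀ ℕ => c (l + Finsupp.single i 1) * ((l i : R) + 1) * m l) a := by
  rw [← (add_left_injective (Finsupp.single i 1)).hasSum_iff]
  · refine iff_of_eq (congrArg (fun F => HasSum F a) (funext fun l => ?_))
    simp
  · intro l hl
    have : l i = 0 := by
      by_contra h
      exact hl ⟨l - Finsupp.single i 1, tsub_add_cancel_of_le (by simpa using by omega)⟩
    simp [this]

end Radius

/-! ### Sums of series: algebra, termwise differentiation, identity theorem -/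

section Eval

variable {σ : Type} [Fintype σ]

theorem norm_prod_pow_le (l : σ →₀ ℕ) (z : σ → ℂ) : ‖∏ i, z i ^ l i‖ ≤ ‖z‖ ^ l.degree := by
  rw [norm_prod, Finsupp.degree_eq_sum, ← Finset.prod_pow_eq_pow_sum]
  refine Finset.prod_le_prod (fun i _ => norm_nonneg _) fun i _ => ?_
  rw [norm_pow]
  exact pow_le_pow_left₀ (norm_nonneg _) (norm_le_pi_norm z i) _

/-- The sum of a power series at a point. -/
def evalSeries (f : MvPowerSeries σ ℂ) (z : σ → ℂ) : ℂ :=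
  ∑' l : σ →₀ ℕ, MvPowerSeries.coeff l f * ∏ i, z i ^ l i

variable {f g : MvPowerSeries σ ℂ} {r : ℝ} {z : σ → ℂ}

theorem HasRadius.summable_norm (hf : HasRadius r f) (hz : ‖z‖ ≤ r) :
    Summable fun l : σ →₀ ℕ => ‖MvPowerSeries.coeff l f * ∏ i, z i ^ l i‖ := by
  refine Summable.of_nonneg_of_le (fun l => norm_nonneg _) (fun l => ?_) hf
  rw [norm_mul]
  gcongr
  exact (norm_prod_pow_le l z).trans (by gcongr)

theorem HasRadius.summable (hf : HasRadius r f) (hz : ‖z‖ ≤ r) :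
    Summable fun l : σ →₀ ℕ => MvPowerSeries.coeff l f * ∏ i, z i ^ l i :=
  (hf.summable_norm hz).of_norm

theorem evalSeries_sub (hf : HasRadius r f) (hg : HasRadius r g) (hz : ‖z‖ ≤ r) :
    evalSeries (f - g) z = evalSeries f z - evalSeries g z := by
  unfold evalSeries
  rw [← (hf.summable hz).tsum_sub (hg.summable hz)]
  exact tsum_congr fun l => by rw [map_sub, sub_mul]

theorem evalSeries_zero (z : σ → ℂ) : evalSeries 0 z = 0 := by simp [evalSeries]

theorem evalSeries_add (hf : HasRadius r f) (hg : HasRadius r g) (hz : ‖z‖ ≤ r) :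
    evalSeries (f + g) z = evalSeries f z + evalSeries g z := by
  unfold evalSeries
  rw [← (hf.summable hz).tsum_add (hg.summable hz)]
  exact tsum_congr fun l => by rw [map_add, add_mul]

theorem evalSeries_sum {ι : Type*} {t : Finset ι} {F : ι → MvPowerSeries σ ℂ} (hr : 0 ≤ r)
    (hF : ∀ i ∈ t, HasRadius r (F i)) (hz : ‖z‖ ≤ r) :
    evalSeries (∑ i ∈ t, F i) z = ∑ i ∈ t, evalSeries (F i) z := by
  classical
  induction t using Finset.induction_on with
  | empty => simp [evalSeries_zero]
  | insert a t ha ih =>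
    rw [Finset.sum_insert ha, Finset.sum_insert ha,
      evalSeries_add (hF a (Finset.mem_insert_self _ _))
        (HasRadius.sum hr fun i hi => hF i (Finset.mem_insert_of_mem hi)) hz,
      ih fun i hi => hF i (Finset.mem_insert_of_mem hi)]

theorem evalSeries_mul (hf : HasRadius r f) (hg : HasRadius r g) (hz : ‖z‖ ≤ r) :
    evalSeries (f * g) z = evalSeries f z * evalSeries g z := by
  classical
  have h := Summable.tsum_mul_tsum_eq_tsum_sum_antidiagonal (hf.summable hz) (hg.summable hz)
    (summable_mul_of_summable_norm (f := fun l : σ →₀ ℕ => MvPowerSeries.coeff l f * ∏ i, z i ^ l i)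
      (g := fun l : σ →₀ ℕ => MvPowerSeries.coeff l g * ∏ i, z i ^ l i)
      (hf.summable_norm hz) (hg.summable_norm hz))
  refine Eq.trans (tsum_congr fun l => ?_) h.symm
  rw [MvPowerSeries.coeff_mul, Finset.sum_mul]
  refine Finset.sum_congr rfl fun p hp => ?_
  rw [← Finset.HasAntidiagonal.mem_antidiagonal.1 hp]
  simp only [Finsupp.add_apply, pow_add, Finset.prod_mul_distrib]
  ring

theorem evalSeries_X (i : σ) (z : σ → ℂ) : evalSeries (MvPowerSeries.X i) z = z i := by
  classical
  unfold evalSeries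
  rw [tsum_eq_single (Finsupp.single i 1)]
  · rw [MvPowerSeries.coeff_X, if_pos rfl, one_mul, Finset.prod_eq_single i]
    · simp
    · intro j _ hj
      simp [hj.symm]
    · simp
  · intro l hl
    rw [MvPowerSeries.coeff_X, if_neg hl, zero_mul]

theorem evalSeries_apply_zero (f : MvPowerSeries σ ℂ) :
    evalSeries f 0 = MvPowerSeries.coeff 0 f := by
  unfold evalSeries
  rw [tsum_eq_single 0]
  · simp
  · intro l hl
    obtain ⟨i, hi⟩ := Finsupp.ne_iff.1 hl
    rw [Finset.prod_eq_zero (Finset.mem_univ i), mul_zero]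
    simpa using hi


theorem hasFDerivAt_monomial (l : σ →₀ ℕ) (z : σ → ℂ) :
    HasFDerivAt (fun z : σ → ℂ => ∏ i, z i ^ l i)
      (∑ i, ((l i : ℂ) * ∏ j, z j ^ (l - Finsupp.single i 1 : σ →₀ ℕ) j) •
        ContinuousLinearMap.proj (R := ℂ) (φ := fun _ : σ => ℂ) i) z := by
  classical
  have h : ∀ i ∈ (Finset.univ : Finset σ), HasFDerivAt (fun z : σ → ℂ => z i ^ l i)
      (((l i : ℂ) * z i ^ (l i - 1)) • ContinuousLinearMap.proj (R := ℂ) (φ := fun _ : σ => ℂ) i)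
      z := by
    intro i _
    have h1 := (hasDerivAt_pow (l i) (z i)).comp_hasFDerivAt z
      (ContinuousLinearMap.proj (R := ℂ) (φ := fun _ : σ => ℂ) i).hasFDerivAt
    exact h1
  refine (HasFDerivAt.finsetProd h).congr_fderiv (Finset.sum_congr rfl fun i _ => ?_)
  rw [smul_smul]
  congr 1
  rw [← Finset.mul_prod_erase _ _ (Finset.mem_univ i)]
  have : ∀ j ∈ Finset.univ.erase i, z j ^ (l - Finsupp.single i 1 : σ →₀ ℕ) j = z j ^ l j := by
    intro j hj
    have hij : i ≠ j := (Finset.ne_of_mem_erase hj).symm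
    simp [hij]
  rw [Finset.prod_congr rfl this]
  simp
  ring

theorem HasRadius.hasFDerivAt (hf : HasRadius r f) (hz : ‖z‖ < r) :
    HasFDerivAt (evalSeries f) (∑ i, evalSeries (MvPowerSeries.pderiv ℂ i f) z •
      ContinuousLinearMap.proj (R := ℂ) (φ := fun _ : σ => ℂ) i) z := by
  -- The derivative series is only known to converge absolutely at radii below `r`, so the summable
  -- bound for termwise differentiation is taken on the ball of an intermediate radius `s`.
  obtain ⟨s, hzs, hsr⟩ := exists_between hz
  have hs0 : 0 ≤ s := (norm_nonneg z).trans hzs.le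
  have hd : ∀ i, HasRadius s (MvPowerSeries.pderiv ℂ i f) := fun i => hf.pderiv hs0 hsr i
  have hu : ∀ i : σ, Summable fun l : σ →₀ ℕ => ‖MvPowerSeries.coeff l f‖ * (l i : ℝ) *
      s ^ (l - Finsupp.single i 1).degree := by
    intro i
    refine ((hasSum_mul_sub_single_iff i (fun l => ‖MvPowerSeries.coeff l f‖)
      (fun l => s ^ l.degree)).2 ((hd i).congr fun l => ?_).hasSum).summable
    rw [MvPowerSeries.coeff_pderiv, norm_mul]
    congr 2
    exact_mod_cast Complex.norm_natCast (l i + 1)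
  have main := hasFDerivAt_tsum_of_isPreconnected (𝕜 := ℂ) (s := Metric.ball (0 : σ → ℂ) s)
    (f := fun (l : σ →₀ ℕ) (z : σ → ℂ) => MvPowerSeries.coeff l f * ∏ i, z i ^ l i)
    (f' := fun l z => MvPowerSeries.coeff l f • ∑ i,
      ((l i : ℂ) * ∏ j, z j ^ (l - Finsupp.single i 1 : σ →₀ ℕ) j) •
        ContinuousLinearMap.proj (R := ℂ) (φ := fun _ : σ => ℂ) i)
    (x₀ := z) (x := z)
    (summable_sum fun i (_ : i ∈ Finset.univ) => hu i) Metric.isOpen_ball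
    (convex_ball (0 : σ → ℂ) s).isPreconnected
    (fun l y _ => (hasFDerivAt_monomial l y).const_mul _)
    (fun l y hy => ?_) (by simpa using hzs) (hf.summable hz.le) (by simpa using hzs)
  · refine main.congr_fderiv ?_
    have hsum : ∀ i, HasSum (fun l : σ →₀ ℕ => MvPowerSeries.coeff l f * (l i : ℂ) *
        ∏ j, z j ^ (l - Finsupp.single i 1 : σ →₀ ℕ) j) (evalSeries (MvPowerSeries.pderiv ℂ i f) z) := by
      intro i
      refine (hasSum_mul_sub_single_iff i (fun l => MvPowerSeries.coeff l f)
        (fun l => ∏ j, z j ^ l j)).2 ?_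
      have := ((hd i).summable hzs.le).hasSum
      simp only [MvPowerSeries.coeff_pderiv] at this
      exact this
    refine HasSum.tsum_eq ?_
    have := hasSum_sum fun i (_ : i ∈ Finset.univ) => (hsum i).smul_const
      (ContinuousLinearMap.proj (R := ℂ) (φ := fun _ : σ => ℂ) i)
    refine this.congr_fun fun l => ?_
    rw [Finset.smul_sum]
    refine Finset.sum_congr rfl fun i _ => ?_
    rw [smul_smul, mul_assoc]
  · have hy' : ‖y‖ ≤ s := by simpa using (Metric.mem_ball.1 hy).le
    rw [norm_smul]
    refine (mul_le_mul_of_nonneg_left (norm_sum_le _ _) (norm_nonneg _)).trans ?_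
    rw [Finset.mul_sum]
    refine Finset.sum_le_sum fun i _ => ?_
    rw [norm_smul, norm_mul, Complex.norm_natCast, mul_assoc ‖_‖]
    have h1 : ‖ContinuousLinearMap.proj (R := ℂ) (φ := fun _ : σ => ℂ) i‖ ≤ 1 :=
      ContinuousLinearMap.opNorm_le_bound _ zero_le_one fun v => by
        simpa using norm_le_pi_norm v i
    have h2 : ‖∏ j, y j ^ (l - Finsupp.single i 1 : σ →₀ ℕ) j‖ ≤ s ^ (l - Finsupp.single i 1).degree :=
      (norm_prod_pow_le _ _).trans (by gcongr)
    calc _ ≤ ‖MvPowerSeries.coeff l f‖ * ((l i : ℝ) * s ^ (l - Finsupp.single i 1).degree * 1) := by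
          gcongr
      _ = _ := by rw [mul_one]

theorem eventually_norm_lt {r : ℝ} (hr : 0 < r) : ∀ᶠ z : σ → ℂ in 𝓝 0, ‖z‖ < r := by
  have := Metric.ball_mem_nhds (0 : σ → ℂ) hr
  filter_upwards [this] with z hz
  simpa using hz

/-- Induction on the degree: the constant coefficient is the value at `0`, and if the sum vanishes
near `0` then so do the sums of the partial derivatives, whose coefficients are nonzero multiples of
the coefficients one degree higher. -/
theorem coeff_eq_zero_of_evalSeries_eventuallyEq_zero (hr : 0 < r) (hf : HasRadius r f)
    (h0 : ∀ᶠ z in 𝓝 0, evalSeries f z = 0) (l : σ →₀ ℕ) : MvPowerSeries.coeff l f = 0 := by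
  classical
  induction hn : l.degree generalizing l f r with
  | zero =>
    rw [Finsupp.degree_eq_zero_iff] at hn
    rw [hn, ← evalSeries_apply_zero, h0.self_of_nhds]
  | succ n ih =>
    obtain ⟨i, hi⟩ : ∃ i, l i ≠ 0 := by
      by_contra! h
      have : l = 0 := Finsupp.ext h
      simp [this] at hn
    obtain ⟨l', rfl⟩ : ∃ l', l = l' + Finsupp.single i 1 :=
      ⟨l - Finsupp.single i 1, (tsub_add_cancel_of_le (by simpa using by omega)).symm⟩
    have hd := ih (half_pos hr) (hf.pderiv (half_pos hr).le (half_lt_self hr) i) (l := l') (by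
      filter_upwards [h0.eventually_nhds, eventually_norm_lt hr] with z hz hzr
      have h1 := hf.hasFDerivAt hzr
      have h2 : HasFDerivAt (evalSeries f) (0 : (σ → ℂ) →L[ℂ] ℂ) z :=
        (hasFDerivAt_const (0 : ℂ) z).congr_of_eventuallyEq hz
      have h3 := congrArg (fun L : (σ → ℂ) →L[ℂ] ℂ => L (Pi.single i 1)) (h1.unique h2)
      simpa [Pi.single_apply] using h3) (by
      rw [map_add, Finsupp.degree_single] at hn
      omega)
    rw [MvPowerSeries.coeff_pderiv] at hd
    exact (mul_eq_zero.1 hd).resolve_right (Nat.cast_add_one_ne_zero _)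

theorem eq_of_evalSeries_eventuallyEq (hr : 0 < r) (hf : HasRadius r f) (hg : HasRadius r g)
    (h : ∀ᶠ z in 𝓝 0, evalSeries f z = evalSeries g z) : f = g := by
  ext l
  have hfg : HasRadius r (f - g) := by
    refine Summable.of_nonneg_of_le (fun l => by positivity) (fun l => ?_) (hf.add hg)
    rw [← add_mul, map_sub]
    gcongr
    exact norm_sub_le _ _
  have := coeff_eq_zero_of_evalSeries_eventuallyEq_zero hr hfg (by
    filter_upwards [h, eventually_norm_lt hr] with z hz hzr
    rw [evalSeries_sub hf hg hzr.le, hz, sub_self]) l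
  rwa [map_sub, sub_eq_zero] at this

end Eval

/-! ### Words in the variables versus multi-indices -/

section Words

variable {σ : Type} [Fintype σ]

/-- The multi-index that counts the letters of a word. -/
def wordCount (w : Σ n : ℕ, Fin n → σ) : σ →₀ ℕ := ∑ k, Finsupp.single (w.2 k) 1

omit [Fintype σ] in
theorem degree_wordCount (w : Σ n : ℕ, Fin n → σ) : (wordCount w).degree = w.1 := by
  simp [wordCount, map_sum, Finsupp.degree_single]

theorem prod_pow_wordCount (w : Σ n : ℕ, Fin n → σ) (z : σ → ℂ) :
    ∏ i, z i ^ wordCount w i = ∏ k, z (w.2 k) := by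
  classical
  unfold wordCount
  simp only [Finsupp.coe_finsetSum, Finset.sum_apply, ← Finset.prod_pow_eq_pow_sum]
  rw [Finset.prod_comm]
  refine Finset.prod_congr rfl fun k _ => ?_
  rw [Finset.prod_eq_single (w.2 k)]
  · simp
  · intro j _ hj
    simp [hj.symm]
  · simp

omit [Fintype σ] in
theorem wordCount_surjective : Function.Surjective (wordCount (σ := σ)) := by
  intro l
  induction hn : l.degree generalizing l with
  | zero =>
    rw [Finsupp.degree_eq_zero_iff] at hn
    exact ⟨⟨0, Fin.elim0⟩, by simp [wordCount, hn]⟩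
  | succ n ih =>
    obtain ⟨i, hi⟩ : ∃ i, l i ≠ 0 := by
      by_contra! h
      have : l = 0 := Finsupp.ext h
      simp [this] at hn
    obtain ⟨l', rfl⟩ : ∃ l', l = l' + Finsupp.single i 1 :=
      ⟨l - Finsupp.single i 1, (tsub_add_cancel_of_le (by simpa using by omega)).symm⟩
    rw [map_add, Finsupp.degree_single] at hn
    obtain ⟨w, hw⟩ := ih l' (by omega)
    refine ⟨⟨w.1 + 1, Fin.cons i w.2⟩, ?_⟩
    rw [← hw, add_comm (wordCount w)]
    simp [wordCount, Fin.sum_univ_succ]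

/-- A word with given letter count. -/
def wordOf : (σ →₀ ℕ) → Σ n : ℕ, Fin n → σ := Function.surjInv wordCount_surjective

omit [Fintype σ] in
theorem wordCount_wordOf (l : σ →₀ ℕ) : wordCount (wordOf l) = l :=
  Function.surjInv_eq wordCount_surjective l

omit [Fintype σ] in
theorem wordOf_injective : Function.Injective (wordOf (σ := σ)) :=
  Function.injective_surjInv wordCount_surjective

theorem summable_word_pow {a : ℕ → ℝ} (ha : ∀ n, 0 ≤ a n)
    (h : Summable fun n => a n * (Fintype.card σ : ℝ) ^ n) :
    Summable fun w : Σ n : ℕ, Fin n → σ => a w.1 := by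
  rw [summable_sigma_of_nonneg fun w => ha w.1]
  refine ⟨fun n => Summable.of_finite, h.congr fun n => ?_⟩
  rw [tsum_fintype]
  simp [mul_comm]

/-- Multi-indices embed into words with degree equal to length, and there are `card σ ^ n` words of
length `n`, so a geometric series dominates. -/
theorem summable_pow_degree {x : ℝ} (hx : 0 ≤ x) (h : x * Fintype.card σ < 1) :
    Summable fun l : σ →₀ ℕ => x ^ l.degree := by
  have := (summable_word_pow (σ := σ) (a := fun n => x ^ n) (fun n => by positivity) (by
    simp_rw [← mul_pow]
    exact summable_geometric_of_lt_one (by positivity) h)).comp_injective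
      (wordOf_injective (σ := σ))
  refine this.congr fun l => ?_
  simp only [Function.comp]
  rw [← degree_wordCount, wordCount_wordOf]

end Words

/-! ### Convergent power series and analytic functions -/

section Analytic

variable {σ : Type} [Fintype σ]

/-- The monomial `∏ k, z (v k)` as a continuous multilinear map. -/
def wordMonomial {n : ℕ} (v : Fin n → σ) :
    ContinuousMultilinearMap ℂ (fun _ : Fin n => σ → ℂ) ℂ :=
  (ContinuousMultilinearMap.mkPiAlgebra ℂ (Fin n) ℂ).compContinuousLinearMap
    fun k => ContinuousLinearMap.proj (v k)

omit [Fintype σ] in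
theorem wordMonomial_apply {n : ℕ} (v : Fin n → σ) (z : Fin n → σ → ℂ) :
    wordMonomial v z = ∏ k, z k (v k) := by
  simp [wordMonomial]

theorem norm_wordMonomial_le {n : ℕ} (v : Fin n → σ) : ‖wordMonomial v‖ ≤ 1 := by
  refine ContinuousMultilinearMap.opNorm_le_bound zero_le_one fun z => ?_
  rw [wordMonomial_apply, one_mul, norm_prod]
  exact Finset.prod_le_prod (fun _ _ => norm_nonneg _) fun k _ => norm_le_pi_norm (z k) _

open Classical in
/-- The coefficients of a power series, spread over the words. -/
def wordCoeff (f : MvPowerSeries σ ℂ) (w : Σ n : ℕ, Fin n → σ) : ℂ :=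
  if wordOf (wordCount w) = w then MvPowerSeries.coeff (wordCount w) f else 0

omit [Fintype σ] in
theorem wordCoeff_wordOf (f : MvPowerSeries σ ℂ) (l : σ →₀ ℕ) :
    wordCoeff f (wordOf l) = MvPowerSeries.coeff l f := by
  rw [wordCoeff, wordCount_wordOf, if_pos rfl]

omit [Fintype σ] in
theorem wordCoeff_eq_zero (f : MvPowerSeries σ ℂ) {w : Σ n : ℕ, Fin n → σ}
    (hw : w ∉ Set.range wordOf) : wordCoeff f w = 0 := by
  rw [wordCoeff, if_neg]
  intro h
  exact hw ⟨_, h⟩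

/-- The formal multilinear series of a power series. -/
def toFormal (f : MvPowerSeries σ ℂ) : FormalMultilinearSeries ℂ (σ → ℂ) ℂ := fun n =>
  ∑ v : Fin n → σ, wordCoeff f ⟨n, v⟩ • wordMonomial v

/-- The whole coefficient at a multi-index is placed on one chosen word, so sums over words reduce
to sums over multi-indices; grouping the words by length gives the homogeneous terms. The
multilinear terms need not be symmetric. -/
theorem HasRadius.hasFPowerSeriesOnBall {f : MvPowerSeries σ ℂ} {r : ℝ} (hr : 0 < r)
    (hf : HasRadius r f) :
    HasFPowerSeriesOnBall (evalSeries f) (toFormal f) 0 (ENNReal.ofReal r) where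
  r_le := by
    have hw : Summable fun w : Σ n : ℕ, Fin n → σ => ‖wordCoeff f w‖ * r ^ w.1 := by
      rw [← (wordOf_injective (σ := σ)).summable_iff]
      · refine hf.congr fun l => ?_
        simp only [Function.comp]
        rw [wordCoeff_wordOf, ← degree_wordCount, wordCount_wordOf]
      · intro w hw
        rw [wordCoeff_eq_zero f hw]
        simp
    refine FormalMultilinearSeries.le_radius_of_bound _
      (∑' w : Σ n : ℕ, Fin n → σ, ‖wordCoeff f w‖ * r ^ w.1) fun n => ?_
    rw [Real.coe_toNNReal _ hr.le]
    calc ‖toFormal f n‖ * r ^ n ≤ (∑ v : Fin n → σ, ‖wordCoeff f ⟨n, v⟩‖) * r ^ n := by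
          gcongr
          refine (norm_sum_le _ _).trans (Finset.sum_le_sum fun v _ => ?_)
          rw [norm_smul]
          exact mul_le_of_le_one_right (norm_nonneg _) (norm_wordMonomial_le v)
      _ = ∑' v : Fin n → σ, ‖wordCoeff f ⟨n, v⟩‖ * r ^ n := by
          rw [tsum_fintype, Finset.sum_mul]
      _ ≤ _ := tsum_comp_le_tsum_of_inj hw (fun w => by positivity) sigma_mk_injective
  r_pos := by simpa using hr
  hasSum := by
    intro z hz
    have hz' : ‖z‖ ≤ r := by
      have := Metric.mem_eball.1 hz
      rw [edist_zero_right, ← ofReal_norm, ENNReal.ofReal_lt_ofReal_iff hr] at this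
      exact this.le
    rw [zero_add]
    have h1 : HasSum (fun w : Σ n : ℕ, Fin n → σ => wordCoeff f w * ∏ k, z (w.2 k))
        (evalSeries f z) := by
      rw [← (wordOf_injective (σ := σ)).hasSum_iff]
      · refine (hf.summable hz').hasSum.congr_fun fun l => ?_
        simp only [Function.comp]
        rw [wordCoeff_wordOf, ← prod_pow_wordCount, wordCount_wordOf]
      · intro w hw
        rw [wordCoeff_eq_zero f hw, zero_mul]
    refine (h1.sigma fun n => hasSum_fintype _).congr_fun fun n => ?_
    simp [toFormal, wordMonomial_apply]

theorem HasRadius.analyticAt {f : MvPowerSeries σ ℂ} {r : ℝ} (hr : 0 < r)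
    (hf : HasRadius r f) : AnalyticAt ℂ (evalSeries f) 0 :=
  (hf.hasFPowerSeriesOnBall hr).analyticAt

/-- Expanding `z` in the standard basis turns the `n`-th homogeneous term into a sum over words of
length `n`; collecting the words with the same letter count yields the coefficients. -/
theorem exists_evalSeries_eventuallyEq {g : (σ → ℂ) → ℂ} (hg : AnalyticAt ℂ g 0) :
    ∃ (f : MvPowerSeries σ ℂ) (r : ℝ), 0 < r ∧ HasRadius r f ∧
      ∀ᶠ z in 𝓝 0, evalSeries f z = g z := by
  classical
  obtain ⟨p, R, hp⟩ := hg
  -- The factor `card σ` pays for the `card σ ^ n` words of length `n`.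
  obtain ⟨ρ, hρ0, hρ⟩ : ∃ ρ : ℝ≥0, 0 < ρ ∧ (ρ * Fintype.card σ : ℝ≥0) < p.radius ∧
      (ρ : ℝ≥0∞) < R := by
    have h1 : ∀ᶠ ρ : ℝ≥0 in 𝓝 0, ((ρ * Fintype.card σ : ℝ≥0) : ℝ≥0∞) < p.radius := by
      have : Tendsto (fun ρ : ℝ≥0 => ((ρ * Fintype.card σ : ℝ≥0) : ℝ≥0∞)) (𝓝 0)
          (𝓝 ((0 * Fintype.card σ : ℝ≥0) : ℝ≥0∞)) :=
        ENNReal.tendsto_coe.2 (tendsto_id.mul_const _)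
      rw [zero_mul, ENNReal.coe_zero] at this
      exact this.eventually_lt_const hp.radius_pos
    have h2 : ∀ᶠ ρ : ℝ≥0 in 𝓝 0, (ρ : ℝ≥0∞) < R := by
      have : Tendsto (fun ρ : ℝ≥0 => (ρ : ℝ≥0∞)) (𝓝 0) (𝓝 ((0 : ℝ≥0) : ℝ≥0∞)) :=
        ENNReal.tendsto_coe.2 tendsto_id
      exact this.eventually_lt_const hp.r_pos
    obtain ⟨ρ, h, hρ⟩ := ((h1.and h2).filter_mono nhdsWithin_le_nhds |>.and
      (self_mem_nhdsWithin (a := (0 : ℝ≥0)) (s := Set.Ioi 0))).exists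
    exact ⟨ρ, hρ, h⟩
  set b : (Σ n : ℕ, Fin n → σ) → ℂ := fun w => p w.1 fun k => Pi.single (w.2 k) 1
  have hb : ∀ w, ‖b w‖ ≤ ‖p w.1‖ := by
    intro w
    refine ((p w.1).le_opNorm _).trans (mul_le_of_le_one_right (norm_nonneg _) ?_)
    refine Finset.prod_le_one (fun _ _ => norm_nonneg _) fun k _ => ?_
    rw [Pi.norm_single, norm_one]
  have hsum : Summable fun w => ‖b w‖ * (ρ : ℝ) ^ w.1 := by
    refine Summable.of_nonneg_of_le (fun w => by positivity)
      (fun w => mul_le_mul_of_nonneg_right (hb w) (by positivity))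
      (summable_word_pow (a := fun n => ‖p n‖ * (ρ : ℝ) ^ n) (fun n => by positivity) ?_)
    refine (p.summable_norm_mul_pow hρ.1).congr fun n => ?_
    push_cast
    rw [mul_pow, mul_assoc]
  let f : MvPowerSeries σ ℂ := fun l => ∑' w : {w // wordCount w = l}, b w.1
  have hf : ∀ l, MvPowerSeries.coeff l f = ∑' w : {w // wordCount w = l}, b w.1 := fun l => rfl
  have hfib := (Equiv.sigmaFiberEquiv (wordCount (σ := σ))).summable_iff.2 hsum
  have hnb : ∀ l, Summable fun w : {w // wordCount w = l} => ‖b w.1‖ := by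
    intro l
    refine ((hfib.sigma_factor l).mul_right (((ρ : ℝ) ^ l.degree)⁻¹)).congr fun w => ?_
    have h1 : w.1.1 = l.degree := by rw [← degree_wordCount, w.2]
    simp only [Function.comp, Equiv.sigmaFiberEquiv, Equiv.coe_fn_mk]
    rw [h1, mul_inv_cancel_right₀ (by positivity)]
  have hR : HasRadius ρ f := by
    refine hasRadius_of_forall_le (by exact_mod_cast hρ0) hfib.sigma fun l => ?_
    rw [hf]
    refine (mul_le_mul_of_nonneg_right (norm_tsum_le_tsum_norm (hnb l)) (by positivity)).trans ?_
    rw [← tsum_mul_right]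
    refine le_of_eq (tsum_congr fun w => ?_)
    have h1 : w.1.1 = l.degree := by rw [← degree_wordCount, w.2]
    simp only [Function.comp, Equiv.sigmaFiberEquiv, Equiv.coe_fn_mk]
    rw [h1]
  refine ⟨f, ρ, by exact_mod_cast hρ0, hR, ?_⟩
  filter_upwards [eventually_norm_lt (σ := σ) (r := ρ) (by exact_mod_cast hρ0)] with z hz
  have hbz : Summable fun w : Σ n : ℕ, Fin n → σ => b w * ∏ k, z (w.2 k) := by
    refine Summable.of_norm_bounded hsum fun w => ?_
    rw [norm_mul, norm_prod]
    gcongr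
    refine (Finset.prod_le_prod (g := fun _ => (ρ : ℝ)) (fun _ _ => norm_nonneg _)
      fun k _ => ?_).trans (by simp)
    exact (norm_le_pi_norm z _).trans hz.le
  have e1 : g z = ∑' w : Σ n : ℕ, Fin n → σ, b w * ∏ k, z (w.2 k) := by
    have h := hp.hasSum (y := z) (by
      rw [Metric.mem_eball, edist_zero_right, ← ofReal_norm]
      refine lt_of_lt_of_le ?_ hρ.2.le
      rw [← ENNReal.ofReal_coe_nnreal]
      exact (ENNReal.ofReal_lt_ofReal_iff (by exact_mod_cast hρ0)).2 hz)
    rw [zero_add] at h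
    rw [hbz.tsum_sigma, ← h.tsum_eq]
    refine tsum_congr fun n => ?_
    rw [tsum_fintype]
    conv_lhs => rw [show (fun _ : Fin n => z) = fun _ => ∑ i, z i • (Pi.single i (1 : ℂ) : σ → ℂ)
      from funext fun _ => by
        ext j
        simp [Finset.sum_apply, Pi.single_apply]]
    rw [ContinuousMultilinearMap.map_sum]
    refine Finset.sum_congr rfl fun v _ => ?_
    rw [ContinuousMultilinearMap.map_smul_univ, smul_eq_mul, mul_comm]
  rw [e1, ← (Equiv.sigmaFiberEquiv (wordCount (σ := σ))).tsum_eq]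
  refine Eq.trans ?_ ((Equiv.sigmaFiberEquiv
    (wordCount (σ := σ))).summable_iff.2 hbz).tsum_sigma.symm
  refine tsum_congr fun l => ?_
  rw [hf, ← tsum_mul_right]
  refine tsum_congr fun w => ?_
  obtain ⟨w, rfl⟩ := w
  rw [prod_pow_wordCount]
  rfl

end Analytic

/-! ### Freezing a group of variables -/

section Slice

variable {α β : Type} [Fintype α] [Fintype β]

theorem degree_sumElim (a : α →₀ ℕ) (b : β →₀ ℕ) :
    (Finsupp.sumElim a b).degree = a.degree + b.degree := by
  simp [Finsupp.degree_eq_sum]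

theorem prod_pow_sumElim (a : α →₀ ℕ) (b : β →₀ ℕ) (x : α → ℂ) (z : β → ℂ) :
    ∏ i, Sum.elim x z i ^ Finsupp.sumElim a b i = (∏ i, x i ^ a i) * ∏ i, z i ^ b i := by
  simp

/-- The series in the remaining variables obtained by giving the first ones the value `x`. -/
def sliceSeries (F : MvPowerSeries (α ⊕ β) ℂ) (x : α → ℂ) : MvPowerSeries β ℂ := fun b =>
  ∑' a : α →₀ ℕ, MvPowerSeries.coeff (Finsupp.sumElim a b) F * ∏ i, x i ^ a i

omit [Fintype β] in
theorem coeff_sliceSeries (F : MvPowerSeries (α ⊕ β) ℂ) (x : α → ℂ) (b : β →₀ ℕ) :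
    MvPowerSeries.coeff b (sliceSeries F x) =
      ∑' a : α →₀ ℕ, MvPowerSeries.coeff (Finsupp.sumElim a b) F * ∏ i, x i ^ a i := rfl

variable {F : MvPowerSeries (α ⊕ β) ℂ} {r : ℝ}

/-- The multi-index of the remaining variables comes first, so that fixing it leaves the sum over
the frozen variables that defines a coefficient of the slice. -/
theorem HasRadius.summable_prod (hF : HasRadius r F) :
    Summable fun p : (β →₀ ℕ) × (α →₀ ℕ) =>
      ‖MvPowerSeries.coeff (Finsupp.sumElim p.2 p.1) F‖ * r ^ p.2.degree * r ^ p.1.degree := by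
  refine (((Equiv.prodComm _ _).trans
    (Finsupp.sumFinsuppEquivProdFinsupp (α := α) (β := β) (γ := ℕ)).symm).summable_iff.2
      hF).congr fun p => ?_
  change ‖MvPowerSeries.coeff (Finsupp.sumElim p.2 p.1) F‖ *
    r ^ (Finsupp.sumElim p.2 p.1).degree = _
  rw [degree_sumElim, pow_add, mul_assoc]

theorem HasRadius.slice (hr : 0 < r) (hF : HasRadius r F) {x : α → ℂ} (hx : ‖x‖ ≤ r) :
    HasRadius r (sliceSeries F x) := by
  have h := hF.summable_prod
  refine hasRadius_of_forall_le hr h.prod fun b => ?_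
  have hb := h.prod_factor b
  have hle : ∀ a : α →₀ ℕ, ‖MvPowerSeries.coeff (Finsupp.sumElim a b) F * ∏ i, x i ^ a i‖ *
      r ^ b.degree ≤ ‖MvPowerSeries.coeff (Finsupp.sumElim a b) F‖ * r ^ a.degree *
      r ^ b.degree := by
    intro a
    rw [norm_mul]
    gcongr
    exact (norm_prod_pow_le _ _).trans (by gcongr)
  have hs : Summable fun a : α →₀ ℕ =>
      ‖MvPowerSeries.coeff (Finsupp.sumElim a b) F * ∏ i, x i ^ a i‖ * r ^ b.degree :=
    Summable.of_nonneg_of_le (fun a => by positivity) hle hb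
  have hs' : Summable fun a : α →₀ ℕ =>
      ‖MvPowerSeries.coeff (Finsupp.sumElim a b) F * ∏ i, x i ^ a i‖ :=
    (summable_mul_right_iff (by positivity)).1 hs
  rw [coeff_sliceSeries]
  calc _ ≤ (∑' a : α →₀ ℕ, ‖MvPowerSeries.coeff (Finsupp.sumElim a b) F * ∏ i, x i ^ a i‖) *
        r ^ b.degree := by
        gcongr
        exact norm_tsum_le_tsum_norm hs'
    _ ≤ _ := by
        rw [← tsum_mul_right]
        exact hs.tsum_le_tsum hle hb

theorem HasRadius.evalSeries_slice (hF : HasRadius r F) {x : α → ℂ} (hx : ‖x‖ ≤ r)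
    {z : β → ℂ} (hz : ‖z‖ ≤ r) :
    evalSeries (sliceSeries F x) z = evalSeries F (Sum.elim x z) := by
  have hr : 0 ≤ r := (norm_nonneg x).trans hx
  have hxz : ‖(Sum.elim x z : α ⊕ β → ℂ)‖ ≤ r := by
    rw [pi_norm_le_iff_of_nonneg hr]
    rintro (i | i)
    · exact (norm_le_pi_norm x i).trans hx
    · exact (norm_le_pi_norm z i).trans hz
  have h := (((Equiv.prodComm _ _).trans
    (Finsupp.sumFinsuppEquivProdFinsupp (α := α) (β := β) (γ := ℕ)).symm).summable_iff.2
      (hF.summable hxz)).tsum_prod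
  have h' := ((Equiv.prodComm _ _).trans
    (Finsupp.sumFinsuppEquivProdFinsupp (α := α) (β := β) (γ := ℕ)).symm).tsum_eq
      (fun l : α ⊕ β →₀ ℕ => MvPowerSeries.coeff l F * ∏ i, Sum.elim x z i ^ l i)
  refine Eq.trans ?_ (h.symm.trans h')
  refine tsum_congr fun b => ?_
  rw [coeff_sliceSeries, ← tsum_mul_right]
  refine tsum_congr fun a => ?_
  change _ = MvPowerSeries.coeff (Finsupp.sumElim a b) F *
    ∏ i, Sum.elim x z i ^ (Finsupp.sumElim a b) i
  rw [prod_pow_sumElim, mul_assoc]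

end Slice

/-! ### Adding variables and setting variables to zero -/

section Lift

variable {σ τ : Type}

/-- A power series as a series in more variables. -/
def liftSeries (f : MvPowerSeries σ ℂ) : MvPowerSeries (σ ⊕ τ) ℂ :=
  MvPowerSeries.rename (R := ℂ) (Function.Embedding.inl : σ ↪ σ ⊕ τ) f

/-- The series obtained by setting the last variables equal to zero. -/
def restrictSeries : MvPowerSeries (σ ⊕ τ) ℂ →ₐ[ℂ] MvPowerSeries σ ℂ :=
  MvPowerSeries.killCompl (R := ℂ) (Function.Embedding.inl : σ ↪ σ ⊕ τ)

theorem restrictSeries_liftSeries (f : MvPowerSeries σ ℂ) :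
    restrictSeries (liftSeries f : MvPowerSeries (σ ⊕ τ) ℂ) = f :=
  MvPowerSeries.killCompl_rename_app f

theorem coeff_restrictSeries (g : MvPowerSeries (σ ⊕ τ) ℂ) (l : σ →₀ ℕ) :
    MvPowerSeries.coeff l (restrictSeries g) =
      MvPowerSeries.coeff (l.embDomain Function.Embedding.inl) g :=
  MvPowerSeries.coeff_killCompl _ _

theorem coeff_embDomain_liftSeries (f : MvPowerSeries σ ℂ) (l : σ →₀ ℕ) :
    MvPowerSeries.coeff (l.embDomain (Function.Embedding.inl : σ ↪ σ ⊕ τ)) (liftSeries f) =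
      MvPowerSeries.coeff l f :=
  MvPowerSeries.coeff_embDomain_rename _ _ _

theorem coeff_liftSeries_eq_zero (f : MvPowerSeries σ ℂ) {l : σ ⊕ τ →₀ ℕ}
    (hl : l ∉ Set.range (Finsupp.embDomain (Function.Embedding.inl : σ ↪ σ ⊕ τ))) :
    MvPowerSeries.coeff l (liftSeries f) = 0 := by
  refine MvPowerSeries.coeff_rename_eq_zero _ _ ?_
  rintro ⟨x, hx⟩
  exact hl ⟨x, by rw [← hx, Finsupp.embDomain_eq_mapDomain]⟩

theorem restrictSeries_pderiv (i : σ) (g : MvPowerSeries (σ ⊕ τ) ℂ) :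
    restrictSeries (MvPowerSeries.pderiv ℂ (Sum.inl i) g) =
      MvPowerSeries.pderiv ℂ i (restrictSeries g) := by
  ext l
  rw [coeff_restrictSeries, MvPowerSeries.coeff_pderiv, MvPowerSeries.coeff_pderiv,
    coeff_restrictSeries, Finsupp.embDomain_add, Finsupp.embDomain_single]
  congr 2
  exact congrArg Nat.cast (Finsupp.embDomain_apply_self Function.Embedding.inl l i)

theorem embDomain_inl_apply_inr (l : σ →₀ ℕ) (k : τ) :
    l.embDomain (Function.Embedding.inl : σ ↪ σ ⊕ τ) (Sum.inr k) = 0 :=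
  Finsupp.embDomain_of_notMem_range _ _ _ (by simp)

theorem embDomain_inl_apply_inl (l : σ →₀ ℕ) (k : σ) :
    l.embDomain (Function.Embedding.inl : σ ↪ σ ⊕ τ) (Sum.inl k) = l k :=
  Finsupp.embDomain_apply_self Function.Embedding.inl l k

theorem pderiv_inr_liftSeries (k : τ) (f : MvPowerSeries σ ℂ) :
    MvPowerSeries.pderiv ℂ (Sum.inr k) (liftSeries f : MvPowerSeries (σ ⊕ τ) ℂ) = 0 := by
  ext l
  rw [MvPowerSeries.coeff_pderiv, coeff_liftSeries_eq_zero, zero_mul, map_zero]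
  rintro ⟨x, hx⟩
  have := DFunLike.congr_fun hx (Sum.inr k)
  rw [embDomain_inl_apply_inr] at this
  simp at this

theorem pderiv_comm (i j : σ) (f : MvPowerSeries σ ℂ) :
    MvPowerSeries.pderiv ℂ i (MvPowerSeries.pderiv ℂ j f) =
      MvPowerSeries.pderiv ℂ j (MvPowerSeries.pderiv ℂ i f) := by
  classical
  ext l
  simp only [MvPowerSeries.coeff_pderiv]
  rw [add_right_comm]
  by_cases h : i = j
  · subst h; rfl
  · simp [h, Ne.symm h]
    ring

/-- The factor produced by `n` differentiations is `(l i + n)! / (l i)!`, stated without division.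
-/
theorem coeff_iterate_pderiv (i : σ) (n : ℕ) (f : MvPowerSeries σ ℂ) (l : σ →₀ ℕ) :
    MvPowerSeries.coeff l ((MvPowerSeries.pderiv ℂ i)^[n] f) * (l i).factorial =
      MvPowerSeries.coeff (l + Finsupp.single i n) f * (l i + n).factorial := by
  induction n generalizing l with
  | zero => simp
  | succ n ih =>
    have h := ih (l + Finsupp.single i 1)
    rw [Function.iterate_succ_apply', MvPowerSeries.coeff_pderiv]
    have e1 : (l + Finsupp.single i 1 : σ →₀ ℕ) i = l i + 1 := by simp
    rw [e1, add_assoc l, ← Finsupp.single_add, Nat.factorial_succ, add_comm 1 n,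
      show l i + 1 + n = l i + (n + 1) by ring] at h
    rw [← h]
    push_cast
    ring

variable [Fintype σ] [Fintype τ]

theorem evalSeries_restrictSeries (g : MvPowerSeries (σ ⊕ τ) ℂ) (p : σ → ℂ) :
    evalSeries (restrictSeries g) p = evalSeries g (Sum.elim p 0) := by
  unfold evalSeries
  rw [← (Finsupp.embDomain_injective (Function.Embedding.inl : σ ↪ σ ⊕ τ)).tsum_eq]
  · refine tsum_congr fun l => ?_
    rw [coeff_restrictSeries]
    simp
  · intro l hl
    rw [Function.mem_support] at hl
    have h0 : ∀ k, l (Sum.inr k) = 0 := by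
      intro k
      by_contra h
      refine hl ?_
      rw [Finset.prod_eq_zero (Finset.mem_univ (Sum.inr k)) (by simpa using h), mul_zero]
    refine ⟨l.comapDomain Sum.inl Sum.inl_injective.injOn, ?_⟩
    ext (k | k)
    · rw [embDomain_inl_apply_inl, Finsupp.comapDomain_apply]
    · rw [embDomain_inl_apply_inr, h0]

theorem evalSeries_liftSeries (f : MvPowerSeries σ ℂ) (p : σ ⊕ τ → ℂ) :
    evalSeries (liftSeries f) p = evalSeries f fun i => p (Sum.inl i) := by
  unfold evalSeries
  rw [← (Finsupp.embDomain_injective (Function.Embedding.inl : σ ↪ σ ⊕ τ)).tsum_eq]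
  · refine tsum_congr fun l => ?_
    rw [coeff_embDomain_liftSeries]
    simp
  · intro l hl
    rw [Function.mem_support] at hl
    by_contra h
    exact hl (by rw [coeff_liftSeries_eq_zero f h, zero_mul])

omit [Fintype σ] [Fintype τ] in
theorem degree_embDomain_inl (l : σ →₀ ℕ) :
    (l.embDomain (Function.Embedding.inl : σ ↪ σ ⊕ τ)).degree = l.degree := by
  rw [Finsupp.embDomain_eq_mapDomain, Finsupp.degree_mapDomain]

omit [Fintype σ] [Fintype τ] in
theorem HasRadius.lift {r : ℝ} {f : MvPowerSeries σ ℂ} (hf : HasRadius r f) :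
    HasRadius r (liftSeries f : MvPowerSeries (σ ⊕ τ) ℂ) := by
  unfold HasRadius
  rw [← (Finsupp.embDomain_injective (Function.Embedding.inl : σ ↪ σ ⊕ τ)).summable_iff]
  · refine hf.congr fun l => ?_
    simp only [Function.comp]
    rw [coeff_embDomain_liftSeries, degree_embDomain_inl]
  · intro l hl
    rw [coeff_liftSeries_eq_zero f hl]
    simp

omit [Fintype σ] [Fintype τ] in
theorem HasRadius.restrict {r : ℝ} {g : MvPowerSeries (σ ⊕ τ) ℂ} (hg : HasRadius r g) :
    HasRadius r (restrictSeries g) := by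
  refine (hg.comp_injective
    (Finsupp.embDomain_injective (Function.Embedding.inl : σ ↪ σ ⊕ τ))).congr fun l => ?_
  simp only [Function.comp]
  rw [coeff_restrictSeries, degree_embDomain_inl]

end Lift

/-! ### The Lie series and its convergence -/

section FlowSeries

variable {σ : Type} [Fintype σ]

omit [Fintype σ] in
/-- The coefficients in `t` determine a series in `z, t`. -/
theorem eq_of_restrictSeries_iterate_pderiv {g h : MvPowerSeries (σ ⊕ Unit) ℂ}
    (H : ∀ n, restrictSeries ((MvPowerSeries.pderiv ℂ (Sum.inr ()))^[n] g) =
      restrictSeries ((MvPowerSeries.pderiv ℂ (Sum.inr ()))^[n] h)) : g = h := by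
  ext l
  have h1 := congrArg (MvPowerSeries.coeff (l.comapDomain Sum.inl Sum.inl_injective.injOn))
    (H (l (Sum.inr ())))
  rw [coeff_restrictSeries, coeff_restrictSeries] at h1
  have hg := coeff_iterate_pderiv (Sum.inr ()) (l (Sum.inr ())) g
    ((l.comapDomain Sum.inl Sum.inl_injective.injOn).embDomain Function.Embedding.inl)
  have hh := coeff_iterate_pderiv (Sum.inr ()) (l (Sum.inr ())) h
    ((l.comapDomain Sum.inl Sum.inl_injective.injOn).embDomain Function.Embedding.inl)
  have hl : (l.comapDomain Sum.inl Sum.inl_injective.injOn).embDomain Function.Embedding.inl +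
      Finsupp.single (Sum.inr ()) (l (Sum.inr ())) = l := by
    ext (k | k)
    · rw [Finsupp.add_apply, embDomain_inl_apply_inl]
      simp
    · rw [Finsupp.add_apply, embDomain_inl_apply_inr]
      simp
  rw [hl] at hg hh
  rw [h1, hh] at hg
  exact (mul_right_cancel₀ (by exact_mod_cast Nat.factorial_ne_zero _) hg).symm

/-- The derivation of series in `z, t` defined by a field that does not depend on `t`. -/
def liftDeriv (X : σ → MvPowerSeries σ ℂ) (g : MvPowerSeries (σ ⊕ Unit) ℂ) :
    MvPowerSeries (σ ⊕ Unit) ℂ :=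
  ∑ k, liftSeries (X k) * MvPowerSeries.pderiv ℂ (Sum.inl k) g

theorem restrictSeries_liftDeriv (X : σ → MvPowerSeries σ ℂ) (g : MvPowerSeries (σ ⊕ Unit) ℂ) :
    restrictSeries (liftDeriv X g) = fieldDeriv X (restrictSeries g) := by
  rw [liftDeriv, map_sum, fieldDeriv_apply]
  refine Finset.sum_congr rfl fun k _ => ?_
  rw [map_mul, restrictSeries_liftSeries, restrictSeries_pderiv]

/-- The field is independent of `t`, so the Leibniz term vanishes and the time derivative commutes
with the derivation. -/
theorem pderiv_liftDeriv (X : σ → MvPowerSeries σ ℂ) (g : MvPowerSeries (σ ⊕ Unit) ℂ) :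
    MvPowerSeries.pderiv ℂ (Sum.inr ()) (liftDeriv X g) =
      liftDeriv X (MvPowerSeries.pderiv ℂ (Sum.inr ()) g) := by
  rw [liftDeriv, liftDeriv, map_sum]
  refine Finset.sum_congr rfl fun k _ => ?_
  rw [Derivation.leibniz, pderiv_inr_liftSeries, pderiv_comm]
  simp

theorem iterate_pderiv_liftDeriv (X : σ → MvPowerSeries σ ℂ) (g : MvPowerSeries (σ ⊕ Unit) ℂ)
    (n : ℕ) : (MvPowerSeries.pderiv ℂ (Sum.inr ()))^[n] (liftDeriv X g) =
      liftDeriv X ((MvPowerSeries.pderiv ℂ (Sum.inr ()))^[n] g) := by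
  induction n with
  | zero => rfl
  | succ n ih => rw [Function.iterate_succ_apply', ih, pderiv_liftDeriv,
      ← Function.iterate_succ_apply' (MvPowerSeries.pderiv ℂ (Sum.inr ()))]

/-- A solution of the linear equation `∂_t g = D_X g` is thus determined by its value at `t = 0`;
this is the uniqueness principle behind the nonlinear equation as well. -/
theorem restrictSeries_iterate_pderiv {X : σ → MvPowerSeries σ ℂ}
    {g : MvPowerSeries (σ ⊕ Unit) ℂ}
    (hg : MvPowerSeries.pderiv ℂ (Sum.inr ()) g = liftDeriv X g) (n : ℕ) :
    restrictSeries ((MvPowerSeries.pderiv ℂ (Sum.inr ()))^[n] g) =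
      (fieldDeriv X ^ n) (restrictSeries g) := by
  induction n with
  | zero => rfl
  | succ n ih =>
    rw [Function.iterate_succ_apply, hg, iterate_pderiv_liftDeriv, restrictSeries_liftDeriv, ih,
      pow_succ']
    rfl

/-- The Lie series of the flow of `X`: its coefficient at `z^j t^n` is that of `z^j` in
`D_X^n z_i / n!`. -/
def flowSeries (X : σ → MvPowerSeries σ ℂ) (i : σ) : MvPowerSeries (σ ⊕ Unit) ℂ := fun l =>
  MvPowerSeries.coeff (l.comapDomain Sum.inl Sum.inl_injective.injOn)
    ((fieldDeriv X ^ l (Sum.inr ())) (MvPowerSeries.X i)) / (l (Sum.inr ())).factorial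

theorem coeff_flowSeries (X : σ → MvPowerSeries σ ℂ) (i : σ) (l : σ ⊕ Unit →₀ ℕ) :
    MvPowerSeries.coeff l (flowSeries X i) =
      MvPowerSeries.coeff (l.comapDomain Sum.inl Sum.inl_injective.injOn)
        ((fieldDeriv X ^ l (Sum.inr ())) (MvPowerSeries.X i)) / (l (Sum.inr ())).factorial := rfl

theorem restrictSeries_iterate_pderiv_flowSeries (X : σ → MvPowerSeries σ ℂ) (i : σ) (n : ℕ) :
    restrictSeries ((MvPowerSeries.pderiv ℂ (Sum.inr ()))^[n] (flowSeries X i)) =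
      (fieldDeriv X ^ n) (MvPowerSeries.X i) := by
  ext l
  have h := coeff_iterate_pderiv (Sum.inr ()) n (flowSeries X i)
    (l.embDomain Function.Embedding.inl)
  rw [embDomain_inl_apply_inr, Nat.factorial_zero, Nat.cast_one, mul_one, zero_add,
    coeff_flowSeries] at h
  rw [coeff_restrictSeries, h]
  have h1 : (l.embDomain Function.Embedding.inl + Finsupp.single (Sum.inr ()) n :
      σ ⊕ Unit →₀ ℕ) (Sum.inr ()) = n := by
    rw [Finsupp.add_apply, embDomain_inl_apply_inr]
    simp
  have h2 : (l.embDomain Function.Embedding.inl + Finsupp.single (Sum.inr ()) n :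
      σ ⊕ Unit →₀ ℕ).comapDomain Sum.inl Sum.inl_injective.injOn = l := by
    ext k
    rw [Finsupp.comapDomain_apply, Finsupp.add_apply, embDomain_inl_apply_inl]
    simp
  rw [h1, h2, div_mul_cancel₀]
  exact_mod_cast n.factorial_ne_zero

theorem restrictSeries_flowSeries (X : σ → MvPowerSeries σ ℂ) (i : σ) :
    restrictSeries (flowSeries X i) = MvPowerSeries.X i :=
  restrictSeries_iterate_pderiv_flowSeries X i 0

/-- Both sides have the same Taylor coefficients in `t`: their `n`-th time derivatives at `t = 0`
are `D_X ^ (n + 1) z_i`. -/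
theorem pderiv_flowSeries (X : σ → MvPowerSeries σ ℂ) (i : σ) :
    MvPowerSeries.pderiv ℂ (Sum.inr ()) (flowSeries X i) = liftDeriv X (flowSeries X i) := by
  refine eq_of_restrictSeries_iterate_pderiv fun n => ?_
  rw [← Function.iterate_succ_apply, restrictSeries_iterate_pderiv_flowSeries,
    iterate_pderiv_liftDeriv, restrictSeries_liftDeriv, restrictSeries_iterate_pderiv_flowSeries,
    pow_succ']
  rfl

theorem degree_eq_add (l : σ ⊕ Unit →₀ ℕ) :
    l.degree = (l.comapDomain Sum.inl Sum.inl_injective.injOn).degree + l (Sum.inr ()) := by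
  simp [Finsupp.degree_eq_sum]

theorem exists_pos_le_of_finite {ι : Type*} [Finite ι] {p : ι → ℝ → Prop}
    (hp : ∀ i r s, 0 ≤ s → s ≤ r → p i r → p i s) (h : ∀ i, ∃ r > 0, p i r) :
    ∃ r > 0, ∀ i, p i r := by
  choose r hr0 hr using h
  rcases isEmpty_or_nonempty ι with hι | hι
  · exact ⟨1, one_pos, fun i => (hι.false i).elim⟩
  · obtain ⟨i₀, hi₀⟩ := Finite.exists_min r
    exact ⟨r i₀, hr0 i₀, fun i => hp i _ _ (hr0 i₀).le (hi₀ i) (hr i)⟩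

theorem hasRadius_of_coeff_le {f : MvPowerSeries σ ℂ} {A C : ℝ} (hA : 0 ≤ A)
    (h : ∀ l, ‖MvPowerSeries.coeff l f‖ ≤ C * A ^ l.degree) : ∃ r > 0, HasRadius r f := by
  set N : ℝ := (Fintype.card σ : ℝ)
  have hN : 0 ≤ N := Nat.cast_nonneg _
  -- With this radius `A * r * card σ < 1`, as `summable_pow_degree` requires.
  set r : ℝ := 1 / ((A + 1) * (N + 1))
  have hr : 0 < r := by positivity
  refine ⟨r, hr, hasRadius_of_forall_le hr ((summable_pow_degree (σ := σ) (x := A * r)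
    (by positivity) ?_).mul_left C) fun l => ?_⟩
  · change A * (1 / ((A + 1) * (N + 1))) * N < 1
    rw [mul_one_div, div_mul_eq_mul_div, div_lt_one (by positivity)]
    nlinarith
  · rw [mul_pow, ← mul_assoc]
    gcongr
    exact h l

/-- The coefficients of iterated derivatives along convergent fields grow at most
geometrically. -/
theorem exists_norm_coeff_iterFieldDeriv_le {κ : Type} [Finite κ]
    {X : κ → σ → MvPowerSeries σ ℂ} (hX : ∀ k i, ∃ r > 0, HasRadius r (X k i)) :
    ∃ A ≥ 0, ∃ C : ℝ, ∀ (n : ℕ) (j : σ →₀ ℕ) (i : σ) (w : Fin n → κ),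
      ‖MvPowerSeries.coeff j (iterFieldDeriv n (MvPowerSeries.X i) fun k => X (w k))‖ /
        n.factorial ≤ C * A ^ (j.degree + n) := by
  obtain ⟨R, hR, hXR⟩ := exists_pos_le_of_finite (ι := κ × σ)
    (p := fun p r => HasRadius r (X p.1 p.2)) (fun p r s hs hsr h => h.mono hs hsr)
    fun p => hX p.1 p.2
  set b : κ → ℝ := fun k => (∑ i, truncNorm ⊤ (ENNReal.ofReal R) (X k i)).toReal
  obtain ⟨B, hB0, hB⟩ : ∃ B : ℝ, 1 ≤ B ∧ ∀ k, b k ≤ B := by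
    obtain ⟨B, hB⟩ := (Set.finite_range b).bddAbove
    exact ⟨max 1 B, le_max_left _ _, fun k => (hB ⟨k, rfl⟩).trans (le_max_right _ _)⟩
  set r := R / 2
  have hr : 0 < r := half_pos hR
  have he : 1 ≤ Real.exp 1 := Real.one_le_exp zero_le_one
  -- The Cauchy estimate has the ratio `1 / r` in the space degree and `e * B / r` in the number of
  -- derivations. Since `e ≥ 1` and `B ≥ 1`, the second dominates both.
  refine ⟨Real.exp 1 * B / r, by positivity, 2 * r, fun n j i w => ?_⟩
  refine (norm_coeff_iterFieldDeriv_le j i (fun k => X (w k)) hr (B := fun _ => B)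
    (fun _ => by positivity) fun k => ?_).trans ?_
  · rw [show 2 * r = R by simp only [r]; ring]
    refine (Finset.sum_le_sum fun i _ => truncNorm_mono le_top le_rfl _).trans ?_
    have hfin : ∑ i, truncNorm ⊤ (ENNReal.ofReal R) (X (w k) i) ≠ ⊤ :=
      ENNReal.sum_ne_top.2 fun i _ => (hasRadius_iff_truncNorm_ne_top hR.le).1 (hXR (w k, i))
    rw [← ENNReal.ofReal_toReal hfin]
    exact ENNReal.ofReal_le_ofReal (hB (w k))
  · rw [Finset.prod_const, Finset.card_univ, Fintype.card_fin, pow_add]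
    have h1 : (1 / r) ^ j.degree ≤ (Real.exp 1 * B / r) ^ j.degree := by
      gcongr
      nlinarith
    calc _ = (1 / r) ^ j.degree * (Real.exp 1 * B / r) ^ n * (2 * r) := by
          simp only [div_pow, mul_pow]; ring
      _ ≤ (Real.exp 1 * B / r) ^ j.degree * (Real.exp 1 * B / r) ^ n * (2 * r) := by gcongr
      _ = _ := by ring

theorem exists_hasRadius_flowSeries {X : σ → MvPowerSeries σ ℂ}
    (hX : ∀ i, ∃ r > 0, HasRadius r (X i)) (i : σ) : ∃ r > 0, HasRadius r (flowSeries X i) := by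
  obtain ⟨A, hA, C, h⟩ := exists_norm_coeff_iterFieldDeriv_le (κ := Unit) (X := fun _ => X)
    fun _ => hX
  refine hasRadius_of_coeff_le hA (C := C) fun l => ?_
  have := h (l (Sum.inr ())) (l.comapDomain Sum.inl Sum.inl_injective.injOn) i fun _ => ()
  rw [iterFieldDeriv_const, ← degree_eq_add] at this
  rwa [coeff_flowSeries, norm_div, Complex.norm_natCast]

end FlowSeries

/-! ### Calculus of convergent series near the origin -/

section Convergent

variable {σ : Type}

/-- The series converges absolutely on some polydisc. -/
def IsConvergent (f : MvPowerSeries σ ℂ) : Prop := ∃ r > 0, HasRadius r f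

theorem isConvergent_X (i : σ) : IsConvergent (MvPowerSeries.X i : MvPowerSeries σ ℂ) :=
  ⟨1, one_pos, hasRadius_X 1 i⟩

theorem IsConvergent.pderiv {f : MvPowerSeries σ ℂ} (hf : IsConvergent f) (i : σ) :
    IsConvergent (MvPowerSeries.pderiv ℂ i f) := by
  obtain ⟨r, hr, hf⟩ := hf
  exact ⟨r / 2, half_pos hr, hf.pderiv (half_pos hr).le (half_lt_self hr) i⟩

theorem IsConvergent.iterate_pderiv {f : MvPowerSeries σ ℂ} (hf : IsConvergent f) (i : σ) (n : ℕ) :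
    IsConvergent ((MvPowerSeries.pderiv ℂ i)^[n] f) := by
  induction n with
  | zero => exact hf
  | succ n ih =>
    rw [Function.iterate_succ_apply']
    exact ih.pderiv i

theorem IsConvergent.lift {τ : Type} {f : MvPowerSeries σ ℂ} (hf : IsConvergent f) :
    IsConvergent (liftSeries f : MvPowerSeries (σ ⊕ τ) ℂ) :=
  let ⟨r, hr, hf⟩ := hf
  ⟨r, hr, hf.lift⟩

theorem IsConvergent.restrict {τ : Type} {f : MvPowerSeries (σ ⊕ τ) ℂ} (hf : IsConvergent f) :
    IsConvergent (restrictSeries f) :=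
  let ⟨r, hr, hf⟩ := hf
  ⟨r, hr, hf.restrict⟩

theorem exists_common_hasRadius {ι : Type*} [Finite ι] {f : ι → MvPowerSeries σ ℂ}
    (hf : ∀ i, IsConvergent (f i)) : ∃ r > 0, ∀ i, HasRadius r (f i) :=
  exists_pos_le_of_finite (p := fun i r => HasRadius r (f i))
    (fun _ _ _ hs hsr h => h.mono hs hsr) hf

theorem IsConvergent.sum_mul {ι : Type*} [Fintype ι] {f g : ι → MvPowerSeries σ ℂ}
    (hf : ∀ i, IsConvergent (f i)) (hg : ∀ i, IsConvergent (g i)) :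
    IsConvergent (∑ i, f i * g i) := by
  obtain ⟨r, hr, hf⟩ := exists_common_hasRadius hf
  obtain ⟨s, hs, hg⟩ := exists_common_hasRadius hg
  have hm := lt_min hr hs
  exact ⟨min r s, hm, HasRadius.sum hm.le fun i _ =>
    ((hf i).mono hm.le (min_le_left _ _)).mul hm.le ((hg i).mono hm.le (min_le_right _ _))⟩

variable [Fintype σ]

theorem eventually_evalSeries_sum_mul {ι : Type*} [Fintype ι] {f g : ι → MvPowerSeries σ ℂ}
    (hf : ∀ i, IsConvergent (f i)) (hg : ∀ i, IsConvergent (g i)) :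
    ∀ᶠ z in 𝓝 0, evalSeries (∑ i, f i * g i) z = ∑ i, evalSeries (f i) z * evalSeries (g i) z := by
  obtain ⟨r, hr, hf⟩ := exists_common_hasRadius hf
  obtain ⟨s, hs, hg⟩ := exists_common_hasRadius hg
  have hm := lt_min hr hs
  filter_upwards [eventually_norm_lt hm] with z hz
  have hf' := fun i => (hf i).mono hm.le (min_le_left r s)
  have hg' := fun i => (hg i).mono hm.le (min_le_right r s)
  rw [evalSeries_sum hm.le (fun i _ => (hf' i).mul hm.le (hg' i)) hz.le]
  exact Finset.sum_congr rfl fun i _ => evalSeries_mul (hf' i) (hg' i) hz.le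

theorem IsConvergent.eventually_hasFDerivAt {f : MvPowerSeries σ ℂ} (hf : IsConvergent f) :
    ∀ᶠ z in 𝓝 0, HasFDerivAt (evalSeries f) (∑ i, evalSeries (MvPowerSeries.pderiv ℂ i f) z •
      ContinuousLinearMap.proj (R := ℂ) (φ := fun _ : σ => ℂ) i) z := by
  obtain ⟨r, hr, hf⟩ := hf
  filter_upwards [eventually_norm_lt hr] with z hz using hf.hasFDerivAt hz

theorem IsConvergent.analyticAt {f : MvPowerSeries σ ℂ} (hf : IsConvergent f) :
    AnalyticAt ℂ (evalSeries f) 0 :=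
  let ⟨_, hr, hf⟩ := hf
  hf.analyticAt hr

theorem IsConvergent.eq_of_eventuallyEq {f g : MvPowerSeries σ ℂ} (hf : IsConvergent f)
    (hg : IsConvergent g) (h : ∀ᶠ z in 𝓝 0, evalSeries f z = evalSeries g z) : f = g := by
  obtain ⟨r, hr, hf⟩ := hf
  obtain ⟨s, hs, hg⟩ := hg
  have hm := lt_min hr hs
  exact eq_of_evalSeries_eventuallyEq hm (hf.mono hm.le (min_le_left r s))
    (hg.mono hm.le (min_le_right r s)) h

theorem IsConvergent.fieldDeriv {X : σ → MvPowerSeries σ ℂ} (hX : ∀ i, IsConvergent (X i))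
    {f : MvPowerSeries σ ℂ} (hf : IsConvergent f) : IsConvergent (fieldDeriv X f) :=
  IsConvergent.sum_mul hX fun i => hf.pderiv i

theorem IsConvergent.fieldDeriv_pow {X : σ → MvPowerSeries σ ℂ} (hX : ∀ i, IsConvergent (X i))
    {f : MvPowerSeries σ ℂ} (hf : IsConvergent f) (n : ℕ) :
    IsConvergent ((FlowGerm.fieldDeriv X ^ n) f) := by
  induction n with
  | zero => exact hf
  | succ n ih =>
    rw [pow_succ']
    exact ih.fieldDeriv hX

theorem isConvergent_flowSeries {X : σ → MvPowerSeries σ ℂ} (hX : ∀ i, IsConvergent (X i)) (i : σ) :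
    IsConvergent (flowSeries X i) := exists_hasRadius_flowSeries hX i

end Convergent

/-! ### Existence and uniqueness of the flow -/

section Flow

variable {σ : Type} [Fintype σ]

theorem fieldDeriv_X (X : σ → MvPowerSeries σ ℂ) (i : σ) :
    fieldDeriv X (MvPowerSeries.X i) = X i := by
  classical
  rw [fieldDeriv_apply, Finset.sum_eq_single i]
  · simp
  · intro j _ hj
    rw [MvPowerSeries.pderiv_X_of_ne hj.symm, mul_zero]
  · simp

/-- The point with coordinates `(p, t)`. -/
def timePoint (y : (σ → ℂ) × ℂ) : σ ⊕ Unit → ℂ := Sum.elim y.1 fun _ => y.2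

omit [Fintype σ] in
theorem timePoint_zero : timePoint (0 : (σ → ℂ) × ℂ) = 0 := by
  ext (i | i) <;> rfl

omit [Fintype σ] in
theorem continuous_timePoint : Continuous (timePoint (σ := σ)) := by
  refine continuous_pi fun i => ?_
  rcases i with i | i
  · exact (continuous_apply i).comp continuous_fst
  · exact continuous_snd

omit [Fintype σ] in
theorem tendsto_timePoint : Tendsto (timePoint (σ := σ)) (𝓝 0) (𝓝 0) := by
  have := (continuous_timePoint (σ := σ)).tendsto 0
  rwa [timePoint_zero] at this

omit [Fintype σ] in
theorem hasDerivAt_timePoint (y : (σ → ℂ) × ℂ) :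
    HasDerivAt (fun s => timePoint (y.1, s)) (Sum.elim 0 1 : σ ⊕ Unit → ℂ) y.2 := by
  rw [hasDerivAt_pi]
  rintro (i | i)
  · exact hasDerivAt_const _ _
  · exact hasDerivAt_id _

theorem IsConvergent.eventually_hasDerivAt_time {g : MvPowerSeries (σ ⊕ Unit) ℂ}
    (hg : IsConvergent g) : ∀ᶠ y : (σ → ℂ) × ℂ in 𝓝 0,
      HasDerivAt (fun s => evalSeries g (timePoint (y.1, s)))
        (evalSeries (MvPowerSeries.pderiv ℂ (Sum.inr ()) g) (timePoint y)) y.2 := by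
  filter_upwards [tendsto_timePoint.eventually hg.eventually_hasFDerivAt] with y hy
  have := hy.comp_hasDerivAt y.2 (hasDerivAt_timePoint y)
  refine this.congr_deriv ?_
  simp

/-- `φ` solves the flow equation of `X` near the origin. -/
def IsFlowSeries (X : σ → MvPowerSeries σ ℂ) (φ : σ → MvPowerSeries (σ ⊕ Unit) ℂ) : Prop :=
  (∀ᶠ y : (σ → ℂ) × ℂ in 𝓝 0, ∀ i,
    HasDerivAt (fun s => evalSeries (φ i) (timePoint (y.1, s)))
      (evalSeries (X i) fun k => evalSeries (φ k) (timePoint y)) y.2) ∧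
  ∀ᶠ p : σ → ℂ in 𝓝 0, ∀ i, evalSeries (φ i) (timePoint (p, 0)) = p i

variable {X : σ → MvPowerSeries σ ℂ} {φ : σ → MvPowerSeries (σ ⊕ Unit) ℂ}

omit [Fintype σ] in
theorem tendsto_evalSeries_pi {τ : Type} [Fintype τ] {φ : σ → MvPowerSeries τ ℂ}
    (hφ : ∀ i, IsConvergent (φ i)) (h0 : ∀ i, evalSeries (φ i) 0 = 0) :
    Tendsto (fun u i => evalSeries (φ i) u) (𝓝 0) (𝓝 (0 : σ → ℂ)) := by
  rw [tendsto_pi_nhds]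
  intro i
  have := (hφ i).analyticAt.continuousAt.tendsto
  rwa [h0 i] at this

/-- Uniqueness of the flow: it is given by the Lie series. -/
theorem IsFlowSeries.eq_flowSeries (hX : ∀ i, IsConvergent (X i)) (hφ : ∀ i, IsConvergent (φ i))
    (h : IsFlowSeries X φ) : φ = flowSeries X := by
  obtain ⟨hode, hinit⟩ := h
  have h0 : ∀ i, evalSeries (φ i) 0 = 0 := fun i => by
    have := hinit.self_of_nhds i
    rwa [show timePoint ((0 : σ → ℂ), (0 : ℂ)) = 0 from timePoint_zero] at this
  have hΦ : Tendsto (fun y i => evalSeries (φ i) (timePoint y)) (𝓝 0) (𝓝 (0 : σ → ℂ)) :=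
    (tendsto_evalSeries_pi hφ h0).comp tendsto_timePoint
  -- Along any solution, `∂_t ^ n φ_i = (D_X ^ n z_i) ∘ φ` near the origin: by the chain rule and
  -- the flow equation, differentiating `f ∘ φ` in time gives `(D_X f) ∘ φ`. At `t = 0` this yields
  -- the time coefficients of the Lie series.
  have key : ∀ i n, ∀ᶠ y : (σ → ℂ) × ℂ in 𝓝 0,
      evalSeries ((MvPowerSeries.pderiv ℂ (Sum.inr ()))^[n] (φ i)) (timePoint y) =
        evalSeries ((fieldDeriv X ^ n) (MvPowerSeries.X i))
          fun k => evalSeries (φ k) (timePoint y) := by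
    intro i n
    induction n with
    | zero => exact Eventually.of_forall fun y =>
      (evalSeries_X i fun k => evalSeries (φ k) (timePoint y)).symm
    | succ n ih =>
      have hf : IsConvergent ((fieldDeriv X ^ n) (MvPowerSeries.X i)) :=
        (isConvergent_X i).fieldDeriv_pow hX n
      filter_upwards [ih.eventually_nhds, hode,
        ((hφ i).iterate_pderiv (Sum.inr ()) n).eventually_hasDerivAt_time,
        hΦ.eventually hf.eventually_hasFDerivAt,
        hΦ.eventually (eventually_evalSeries_sum_mul hX fun k => hf.pderiv k)]
        with y hy hy1 hy2 hy3 hy4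
      have hline : Tendsto (fun s : ℂ => (y.1, s)) (𝓝 y.2) (𝓝 y) :=
        (Continuous.prodMk_right y.1).tendsto y.2
      have hd := HasDerivAt.congr_of_eventuallyEq (HasFDerivAt.comp_hasDerivAt
        (f := fun s i => evalSeries (φ i) (timePoint (y.1, s))) y.2 hy3 (hasDerivAt_pi.2 hy1))
        (hline.eventually hy)
      rw [Function.iterate_succ_apply', hy2.unique hd, pow_succ']
      refine Eq.trans ?_ hy4.symm
      simp [mul_comm]
  refine funext fun i => eq_of_restrictSeries_iterate_pderiv fun n => ?_
  rw [restrictSeries_iterate_pderiv_flowSeries]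
  refine IsConvergent.eq_of_eventuallyEq ((hφ i).iterate_pderiv _ n).restrict
    ((isConvergent_X i).fieldDeriv_pow hX n) ?_
  have hline : Tendsto (fun p : σ → ℂ => (p, (0 : ℂ))) (𝓝 0) (𝓝 0) :=
    (Continuous.prodMk_left (0 : ℂ)).tendsto 0
  filter_upwards [hline.eventually (key i n), hinit] with p hp hp0
  rw [evalSeries_restrictSeries]
  refine hp.trans ?_
  rw [show (fun k => evalSeries (φ k) (timePoint (p, 0))) = p from funext hp0]

/-- The chain rule expressed through formal partial derivatives, for a series `H` that represents
the composite; it is read off by applying both derivatives to a basis vector. -/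
theorem IsConvergent.evalSeries_pderiv_comp {τ : Type} [Fintype τ] {f : MvPowerSeries σ ℂ}
    {ψ : σ → MvPowerSeries τ ℂ} {H : MvPowerSeries τ ℂ} (hf : IsConvergent f)
    (hψ : ∀ i, IsConvergent (ψ i)) (h0 : ∀ i, evalSeries (ψ i) 0 = 0) (hH : IsConvergent H)
    (h : ∀ᶠ u in 𝓝 0, evalSeries H u = evalSeries f fun i => evalSeries (ψ i) u) :
    ∀ᶠ u in 𝓝 0, ∀ k, evalSeries (MvPowerSeries.pderiv ℂ k H) u =
      ∑ m, evalSeries (MvPowerSeries.pderiv ℂ m f) (fun i => evalSeries (ψ i) u) *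
        evalSeries (MvPowerSeries.pderiv ℂ k (ψ m)) u := by
  classical
  filter_upwards [h.eventually_nhds, hH.eventually_hasFDerivAt,
    (tendsto_evalSeries_pi hψ h0).eventually hf.eventually_hasFDerivAt,
    eventually_all.2 fun i => (hψ i).eventually_hasFDerivAt] with u hu hu1 hu2 hu3 k
  have hd := HasFDerivAt.congr_of_eventuallyEq (HasFDerivAt.comp
    (f := fun u i => evalSeries (ψ i) u) u hu2 (hasFDerivAt_pi.2 hu3)) hu
  have := congrArg (fun L : (τ → ℂ) →L[ℂ] ℂ => L (Pi.single k 1)) (hu1.unique hd)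
  simpa [Pi.single_apply] using this

theorem evalSeries_liftDeriv_eventually (hX : ∀ i, IsConvergent (X i))
    {g : MvPowerSeries (σ ⊕ Unit) ℂ} (hg : IsConvergent g) :
    ∀ᶠ u in 𝓝 0, evalSeries (liftDeriv X g) u = ∑ k, evalSeries (X k) (fun i => u (Sum.inl i)) *
      evalSeries (MvPowerSeries.pderiv ℂ (Sum.inl k) g) u := by
  filter_upwards [eventually_evalSeries_sum_mul (f := fun k => liftSeries (X k))
    (g := fun k => MvPowerSeries.pderiv ℂ (Sum.inl k) g) (fun k => (hX k).lift)
    fun k => hg.pderiv (Sum.inl k)] with u hu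
  rw [liftDeriv, hu]
  simp only [evalSeries_liftSeries]

theorem evalSeries_flowSeries_init (X : σ → MvPowerSeries σ ℂ) (i : σ) (p : σ → ℂ) :
    evalSeries (flowSeries X i) (Sum.elim p 0) = p i := by
  rw [← evalSeries_restrictSeries, restrictSeries_flowSeries, evalSeries_X]

/-- The time derivative of the Lie series is the field at the Lie series. -/
theorem eventually_evalSeries_pderiv_flowSeries (hX : ∀ i, IsConvergent (X i)) (i : σ) :
    ∀ᶠ u in 𝓝 0, evalSeries (MvPowerSeries.pderiv ℂ (Sum.inr ()) (flowSeries X i)) u =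
      evalSeries (X i) fun k => evalSeries (flowSeries X k) u := by
  have hψ := isConvergent_flowSeries hX
  have hz : (Sum.elim 0 0 : σ ⊕ Unit → ℂ) = 0 := by ext (i | i) <;> rfl
  have h0 : ∀ k, evalSeries (flowSeries X k) 0 = 0 := fun k => by
    have := evalSeries_flowSeries_init X k 0
    rwa [hz] at this
  obtain ⟨H, r, hr, hHr, hH⟩ := exists_evalSeries_eventuallyEq
    (g := fun u => evalSeries (X i) fun k => evalSeries (flowSeries X k) u) (by
      refine AnalyticAt.fun_comp (g := evalSeries (X i)) ?_
        (AnalyticAt.pi fun k => (hψ k).analyticAt)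
      rw [show (fun k => evalSeries (flowSeries X k) 0) = 0 from funext h0]
      exact (hX i).analyticAt)
  have hHc : IsConvergent H := ⟨r, hr, hHr⟩
  -- By the chain rule both sides are the same combination of the derivatives of the components of
  -- the flow, and each component satisfies `∂_t = D_X`.
  have hpde : MvPowerSeries.pderiv ℂ (Sum.inr ()) H = liftDeriv X H := by
    refine IsConvergent.eq_of_eventuallyEq (hHc.pderiv _)
      (IsConvergent.sum_mul (fun k => (hX k).lift) fun k => hHc.pderiv (Sum.inl k)) ?_
    filter_upwards [(hX i).evalSeries_pderiv_comp hψ h0 hHc hH,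
      evalSeries_liftDeriv_eventually hX hHc,
      eventually_all.2 fun m => evalSeries_liftDeriv_eventually hX (hψ m)] with u hu hu1 hu2
    refine (hu _).trans (Eq.trans ?_ hu1.symm)
    simp_rw [pderiv_flowSeries, hu2, hu, Finset.mul_sum]
    rw [Finset.sum_comm]
    exact Finset.sum_congr rfl fun _ _ => Finset.sum_congr rfl fun _ _ => by ring
  have hres : restrictSeries H = X i := by
    refine IsConvergent.eq_of_eventuallyEq hHc.restrict (hX i) ?_
    have hline : Tendsto (fun p : σ → ℂ => (Sum.elim p 0 : σ ⊕ Unit → ℂ)) (𝓝 0) (𝓝 0) := by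
      have : Continuous fun p : σ → ℂ => (Sum.elim p 0 : σ ⊕ Unit → ℂ) :=
        continuous_timePoint.comp (Continuous.prodMk_left (0 : ℂ))
      have := this.tendsto 0
      rwa [hz] at this
    filter_upwards [hline.eventually hH] with p hp
    rw [evalSeries_restrictSeries, hp]
    simp_rw [evalSeries_flowSeries_init]
  -- Both series solve `∂_t g = D_X g` with value `X i = D_X z_i` at `t = 0`, so all their time
  -- coefficients agree.
  have heq : MvPowerSeries.pderiv ℂ (Sum.inr ()) (flowSeries X i) = H := by
    refine eq_of_restrictSeries_iterate_pderiv fun n => ?_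
    rw [restrictSeries_iterate_pderiv hpde, hres, ← Function.iterate_succ_apply,
      restrictSeries_iterate_pderiv_flowSeries, pow_succ]
    change (fieldDeriv X ^ n) (fieldDeriv X (MvPowerSeries.X i)) = _
    rw [fieldDeriv_X]
  rw [heq]
  exact hH

theorem isFlowSeries_flowSeries (hX : ∀ i, IsConvergent (X i)) :
    IsFlowSeries X (flowSeries X) := by
  refine ⟨?_, Eventually.of_forall fun p i => evalSeries_flowSeries_init X i p⟩
  rw [eventually_all]
  intro i
  filter_upwards [(isConvergent_flowSeries hX i).eventually_hasDerivAt_time,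
    tendsto_timePoint.eventually (eventually_evalSeries_pderiv_flowSeries hX i)] with y hy hy1
  rw [← hy1]
  exact hy

end Flow

/-! ### From series to germs -/

section Germ

variable {σ : Type} [Fintype σ]

theorem isConvergent_coe (f : HolGerm σ) : IsConvergent f.1 := by
  obtain ⟨r, hr, hf⟩ := f.2
  refine ⟨r, hr, hf.congr fun l => ?_⟩
  rw [Finsupp.degree_eq_sum]

/-- The germ of a convergent power series. -/
def IsConvergent.germ {f : MvPowerSeries σ ℂ} (hf : IsConvergent f) : HolGerm σ :=
  ⟨f, by
    obtain ⟨r, hr, hf⟩ := hf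
    refine ⟨r, hr, hf.congr fun l => ?_⟩
    rw [Finsupp.degree_eq_sum]⟩

theorem HolGerm.ext_series {f g : HolGerm σ} (h : f.1 = g.1) : f = g := Subtype.ext h

theorem isFlowGerm_iff {m : ℕ} (X : VF m) (φ : FlowSpace m) :
    IsFlowGerm X φ ↔ IsFlowSeries (fun i => (X i).1) fun i => (φ i).1 := by
  unfold IsFlowGerm IsFlowSeries
  simp_rw [hasDerivAt_pi, funext_iff]
  rfl

/-- The flow of a germ of a vector field. -/
def flow {m : ℕ} (X : VF m) : FlowSpace m := fun i =>
  (isConvergent_flowSeries (fun k => isConvergent_coe (X k)) i).germ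

theorem isFlowGerm_flow {m : ℕ} (X : VF m) : IsFlowGerm X (flow X) :=
  (isFlowGerm_iff X _).2 (isFlowSeries_flowSeries fun k => isConvergent_coe (X k))

theorem IsFlowGerm.eq_flow {m : ℕ} {X : VF m} {φ : FlowSpace m} (h : IsFlowGerm X φ) :
    φ = flow X := by
  have := ((isFlowGerm_iff X φ).1 h).eq_flowSeries (fun k => isConvergent_coe (X k))
    fun k => isConvergent_coe (φ k)
  exact funext fun i => HolGerm.ext_series (congrFun this i)

end Germ

/-! ### Analytic dependence on parameters -/

section Families

variable {α β : Type} [Fintype α] [Fintype β]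

theorem analyticAt_sumElim (y : (α → ℂ) × (β → ℂ)) :
    AnalyticAt ℂ (fun y : (α → ℂ) × (β → ℂ) => (Sum.elim y.1 y.2 : α ⊕ β → ℂ)) y := by
  refine AnalyticAt.pi fun i => ?_
  rcases i with i | i
  · exact ((ContinuousLinearMap.proj (R := ℂ) (φ := fun _ : α => ℂ) i).comp
      (ContinuousLinearMap.fst ℂ (α → ℂ) (β → ℂ))).analyticAt y
  · exact ((ContinuousLinearMap.proj (R := ℂ) (φ := fun _ : β => ℂ) i).comp
      (ContinuousLinearMap.snd ℂ (α → ℂ) (β → ℂ))).analyticAt y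

theorem analyticAt_sumSplit (u : α ⊕ β → ℂ) :
    AnalyticAt ℂ (fun u : α ⊕ β → ℂ => ((fun i => u (Sum.inl i)), fun i => u (Sum.inr i))) u :=
  AnalyticAt.prod
    (AnalyticAt.pi fun i =>
      (ContinuousLinearMap.proj (R := ℂ) (φ := fun _ : α ⊕ β => ℂ) (Sum.inl i)).analyticAt u)
    (AnalyticAt.pi fun i =>
      (ContinuousLinearMap.proj (R := ℂ) (φ := fun _ : α ⊕ β => ℂ) (Sum.inr i)).analyticAt u)

omit [Fintype α] [Fintype β] in
theorem sumElim_zero_zero : (Sum.elim 0 0 : α ⊕ β → ℂ) = 0 := by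
  ext (i | i) <;> rfl

theorem tendsto_sumElim : Tendsto (fun y : (α → ℂ) × (β → ℂ) => (Sum.elim y.1 y.2 : α ⊕ β → ℂ))
    (𝓝 0) (𝓝 0) := by
  have := (analyticAt_sumElim (α := α) (β := β) 0).continuousAt.tendsto
  simpa only [Prod.fst_zero, Prod.snd_zero, sumElim_zero_zero] using this

/-- An analytic function of two groups of variables is the sum of a convergent series. -/
theorem exists_isConvergent_evalSeries_sumElim {g : (α → ℂ) × (β → ℂ) → ℂ}
    (hg : AnalyticAt ℂ g 0) : ∃ F : MvPowerSeries (α ⊕ β) ℂ, IsConvergent F ∧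
      ∀ᶠ y in 𝓝 (0 : (α → ℂ) × (β → ℂ)), evalSeries F (Sum.elim y.1 y.2) = g y := by
  obtain ⟨F, r, hr, hF, h⟩ := exists_evalSeries_eventuallyEq
    (g := fun u : α ⊕ β → ℂ => g ((fun i => u (Sum.inl i)), fun i => u (Sum.inr i)))
    (AnalyticAt.fun_comp (g := g) hg (analyticAt_sumSplit (α := α) (β := β) 0))
  refine ⟨F, ⟨r, hr, hF⟩, ?_⟩
  filter_upwards [tendsto_sumElim.eventually h] with y hy using hy

theorem IsConvergent.eventually_evalSeries_slice {F : MvPowerSeries (α ⊕ β) ℂ}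
    (hF : IsConvergent F) :
    ∀ᶠ y in 𝓝 (0 : (α → ℂ) × (β → ℂ)),
      evalSeries (sliceSeries F y.1) y.2 = evalSeries F (Sum.elim y.1 y.2) := by
  obtain ⟨r, hr, hF⟩ := hF
  filter_upwards [Metric.ball_mem_nhds (0 : (α → ℂ) × (β → ℂ)) hr] with y hy
  have hy' : ‖y‖ < r := by simpa using hy
  exact hF.evalSeries_slice ((norm_fst_le y).trans hy'.le) ((norm_snd_le y).trans hy'.le)

theorem IsConvergent.eventually_isConvergent_slice {F : MvPowerSeries (α ⊕ β) ℂ}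
    (hF : IsConvergent F) : ∀ᶠ x in 𝓝 (0 : α → ℂ), IsConvergent (sliceSeries F x) := by
  obtain ⟨r, hr, hF⟩ := hF
  filter_upwards [eventually_norm_lt hr] with x hx using ⟨r, hr, hF.slice hr hx.le⟩

/-- If `D_X z_i = X i` vanishes, so do all higher derivatives `D_X ^ n z_i`, and the coordinate is
constant in time. This keeps the parameters fixed in the enlarged flow. -/
theorem flowSeries_of_eq_zero {X : α → MvPowerSeries α ℂ} {i : α} (h : X i = 0) :
    flowSeries X i = liftSeries (MvPowerSeries.X i) := by
  refine eq_of_restrictSeries_iterate_pderiv fun n => ?_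
  rw [restrictSeries_iterate_pderiv_flowSeries]
  cases n with
  | zero => exact (restrictSeries_liftSeries _).symm
  | succ n =>
    rw [Function.iterate_succ_apply, pderiv_inr_liftSeries, iterate_map_zero, map_zero, pow_succ]
    change (fieldDeriv X ^ n) (fieldDeriv X (MvPowerSeries.X i)) = _
    rw [fieldDeriv_X, h, map_zero]

/-- The flow of a field that depends analytically on parameters depends analytically on them:
its slices are those of a single convergent series. -/
theorem exists_slice_eq_flowSeries {F : β → MvPowerSeries (α ⊕ β) ℂ}
    (hF : ∀ i, IsConvergent (F i)) :
    ∃ Ψ : β → MvPowerSeries (α ⊕ (β ⊕ Unit)) ℂ, (∀ i, IsConvergent (Ψ i)) ∧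
      ∀ᶠ x in 𝓝 (0 : α → ℂ), ∀ i, sliceSeries (Ψ i) x =
        flowSeries (fun k => sliceSeries (F k) x) i := by
  -- The parameters become space variables in which the enlarged field is zero.
  set Y : α ⊕ β → MvPowerSeries (α ⊕ β) ℂ := Sum.elim 0 F with hYdef
  have hY : ∀ i, IsConvergent (Y i) := by
    rintro (i | i)
    · exact ⟨1, one_pos, by simp [hYdef, HasRadius, summable_zero]⟩
    · exact hF i
  have hψ := isConvergent_flowSeries hY
  have hψ0 : ∀ k, evalSeries (flowSeries Y k) 0 = 0 := fun k => by
    have := evalSeries_flowSeries_init Y k 0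
    rwa [sumElim_zero_zero] at this
  -- the reassociation of the variables
  let R : (α → ℂ) × (β ⊕ Unit → ℂ) → (α ⊕ β → ℂ) × ℂ := fun y =>
    (Sum.elim y.1 fun i => y.2 (Sum.inl i), y.2 (Sum.inr ()))
  have hR : AnalyticAt ℂ (fun y => timePoint (R y)) 0 := by
    refine AnalyticAt.pi fun i => ?_
    rcases i with (i | i) | i
    · exact ((ContinuousLinearMap.proj (R := ℂ) (φ := fun _ : α => ℂ) i).comp
        (ContinuousLinearMap.fst ℂ (α → ℂ) (β ⊕ Unit → ℂ))).analyticAt _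
    · exact ((ContinuousLinearMap.proj (R := ℂ) (φ := fun _ : β ⊕ Unit => ℂ) (Sum.inl i)).comp
        (ContinuousLinearMap.snd ℂ (α → ℂ) (β ⊕ Unit → ℂ))).analyticAt _
    · exact ((ContinuousLinearMap.proj (R := ℂ) (φ := fun _ : β ⊕ Unit => ℂ) (Sum.inr ())).comp
        (ContinuousLinearMap.snd ℂ (α → ℂ) (β ⊕ Unit → ℂ))).analyticAt _
  have hR0 : timePoint (R 0) = 0 := by ext ((i | i) | i) <;> rfl
  have hΨ : ∀ i : β, ∃ Ψ : MvPowerSeries (α ⊕ (β ⊕ Unit)) ℂ, IsConvergent Ψ ∧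
      ∀ᶠ y in 𝓝 (0 : (α → ℂ) × (β ⊕ Unit → ℂ)), evalSeries Ψ (Sum.elim y.1 y.2) =
        evalSeries (flowSeries Y (Sum.inr i)) (timePoint (R y)) := fun i => by
    refine exists_isConvergent_evalSeries_sumElim (AnalyticAt.fun_comp ?_ hR)
    rw [hR0]
    exact (hψ _).analyticAt
  choose Ψ hΨc hΨ using hΨ
  refine ⟨Ψ, hΨc, ?_⟩
  -- passage to the variables `(x, (p, t))`
  let Q : (α → ℂ) × ((β → ℂ) × ℂ) → (α ⊕ β → ℂ) × ℂ := fun y => (Sum.elim y.1 y.2.1, y.2.2)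
  let S : (α → ℂ) × ((β → ℂ) × ℂ) → (α → ℂ) × (β ⊕ Unit → ℂ) := fun y => (y.1, timePoint y.2)
  have hS : Tendsto S (𝓝 0) (𝓝 0) := by
    have : Continuous S := continuous_fst.prodMk (continuous_timePoint.comp continuous_snd)
    have h := this.tendsto 0
    rwa [show S 0 = 0 from Prod.ext rfl timePoint_zero] at h
  have hQ : Tendsto Q (𝓝 0) (𝓝 0) := by
    have : Continuous Q := by
      refine Continuous.prodMk (continuous_pi fun i => ?_) (continuous_snd.comp continuous_snd)
      rcases i with i | i
      · exact (continuous_apply i).comp continuous_fst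
      · exact (continuous_apply i).comp (continuous_fst.comp continuous_snd)
    have h := this.tendsto 0
    rwa [show Q 0 = 0 from Prod.ext sumElim_zero_zero rfl] at h
  have hval : ∀ᶠ y in 𝓝 (0 : (α → ℂ) × ((β → ℂ) × ℂ)), ∀ i,
      evalSeries (sliceSeries (Ψ i) y.1) (timePoint y.2) =
        evalSeries (flowSeries Y (Sum.inr i)) (timePoint (Q y)) := by
    refine eventually_all.2 fun i => ?_
    filter_upwards [hS.eventually (hΨc i).eventually_evalSeries_slice, hS.eventually (hΨ i)]
      with y hy hy1 using hy.trans hy1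
  have hxval : ∀ y a, evalSeries (flowSeries Y (Sum.inl a)) (timePoint (Q y)) = y.1 a := by
    intro y a
    rw [flowSeries_of_eq_zero (by rfl), evalSeries_liftSeries, evalSeries_X]
    rfl
  have hz : Tendsto (fun y => (y.1, fun i => evalSeries (flowSeries Y (Sum.inr i))
      (timePoint (Q y)))) (𝓝 (0 : (α → ℂ) × ((β → ℂ) × ℂ))) (𝓝 (0 : (α → ℂ) × (β → ℂ))) := by
    refine Tendsto.prodMk_nhds (continuous_fst.tendsto 0) ?_
    exact (tendsto_evalSeries_pi (fun i => hψ (Sum.inr i)) fun i => hψ0 _).comp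
      (tendsto_timePoint.comp hQ)
  have hode : ∀ᶠ y in 𝓝 (0 : (α → ℂ) × ((β → ℂ) × ℂ)), ∀ i,
      HasDerivAt (fun s => evalSeries (sliceSeries (Ψ i) y.1) (timePoint (y.2.1, s)))
        (evalSeries (sliceSeries (F i) y.1)
          fun k => evalSeries (sliceSeries (Ψ k) y.1) (timePoint y.2)) y.2.2 := by
    filter_upwards [hval.eventually_nhds, hQ.eventually (isFlowSeries_flowSeries hY).1,
      hz.eventually (eventually_all.2 fun i => (hF i).eventually_evalSeries_slice)]
      with y hy hy1 hy2 i
    have hline : Tendsto (fun s : ℂ => (y.1, (y.2.1, s))) (𝓝 y.2.2) (𝓝 y) :=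
      (Continuous.prodMk_right y.1).comp (Continuous.prodMk_right y.2.1) |>.tendsto y.2.2
    have h1 := (hy1 (Sum.inr i)).congr_of_eventuallyEq
      ((hline.eventually hy).mono fun s hs => hs i)
    refine h1.congr_deriv ?_
    rw [show (fun k => evalSeries (sliceSeries (Ψ k) y.1) (timePoint y.2)) =
      fun k => evalSeries (flowSeries Y (Sum.inr k)) (timePoint (Q y)) from
        funext hy.self_of_nhds]
    refine Eq.trans ?_ (hy2 i).symm
    change evalSeries (F i) _ = _
    congr 1
    ext (a | k)
    · exact hxval y a
    · rfl
  have hinit : ∀ᶠ y in 𝓝 (0 : (α → ℂ) × (β → ℂ)), ∀ i,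
      evalSeries (sliceSeries (Ψ i) y.1) (timePoint (y.2, 0)) = y.2 i := by
    have hline : Tendsto (fun y : (α → ℂ) × (β → ℂ) => (y.1, (y.2, (0 : ℂ)))) (𝓝 0) (𝓝 0) :=
      (continuous_fst.prodMk (continuous_snd.prodMk continuous_const)).tendsto 0
    filter_upwards [hline.eventually hval] with y hy i
    rw [hy i]
    exact evalSeries_flowSeries_init Y (Sum.inr i) (Sum.elim y.1 y.2)
  -- The equations hold near the origin of the product. Currying gives, for each small fixed `x`,
  -- equations valid for `(p, t)` near `0`, so uniqueness applies to the slice at `x`.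
  have hode' := (nhds_prod_eq (x := (0 : α → ℂ)) (y := (0 : (β → ℂ) × ℂ)) ▸ hode :
    ∀ᶠ y in 𝓝 (0 : α → ℂ) ×ˢ 𝓝 (0 : (β → ℂ) × ℂ), _).curry
  have hinit' := (nhds_prod_eq (x := (0 : α → ℂ)) (y := (0 : β → ℂ)) ▸ hinit :
    ∀ᶠ y in 𝓝 (0 : α → ℂ) ×ˢ 𝓝 (0 : β → ℂ), _).curry
  filter_upwards [hode', hinit', eventually_all.2 fun i => (hF i).eventually_isConvergent_slice,
    eventually_all.2 fun i => (hΨc i).eventually_isConvergent_slice] with x h1 h2 h3 h4 i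
  exact congrFun (IsFlowSeries.eq_flowSeries (X := fun k => sliceSeries (F k) x)
    (φ := fun k => sliceSeries (Ψ k) x) h3 h4 ⟨h1, h2⟩) i

end Families

theorem quasiStronglyAnalytic_flow (m : ℕ) : QuasiStronglyAnalytic (flow (m := m)) := by
  intro q _ l hl
  have hF : ∀ i, ∃ F : MvPowerSeries (Fin q ⊕ Fin m) ℂ, IsConvergent F ∧
      ∀ᶠ y in 𝓝 (0 : (Fin q → ℂ) × (Fin m → ℂ)),
        evalSeries F (Sum.elim y.1 y.2) = (l y.1 i).eval y.2 := fun i => by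
    refine exists_isConvergent_evalSeries_sumElim ?_
    exact AnalyticAt.fun_comp
      ((ContinuousLinearMap.proj (R := ℂ) (φ := fun _ : Fin m => ℂ) i).analyticAt _) hl
  choose F hFc hF using hF
  -- Holomorphy of the family concerns its values only. The identity theorem upgrades it: for small
  -- `x`, the Taylor series of the members are the slices of one convergent series.
  have hslice : ∀ᶠ x in 𝓝 (0 : Fin q → ℂ), ∀ i, sliceSeries (F i) x = (l x i).1 := by
    refine eventually_all.2 fun i => ?_
    have h := (hFc i).eventually_evalSeries_slice.and (hF i)
    have h' := (nhds_prod_eq (x := (0 : Fin q → ℂ)) (y := (0 : Fin m → ℂ)) ▸ h :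
      ∀ᶠ y in 𝓝 (0 : Fin q → ℂ) ×ˢ 𝓝 (0 : Fin m → ℂ), _).curry
    filter_upwards [h', (hFc i).eventually_isConvergent_slice] with x hx hx1
    exact hx1.eq_of_eventuallyEq (isConvergent_coe _) (hx.mono fun z hz => hz.1.trans hz.2)
  obtain ⟨Ψ, hΨc, hΨ⟩ := exists_slice_eq_flowSeries hFc
  refine AnalyticAt.pi fun i => ?_
  have hval : ∀ᶠ y in 𝓝 (0 : (Fin q → ℂ) × (Fin m ⊕ Unit → ℂ)),
      evalSeries (Ψ i) (Sum.elim y.1 y.2) = evalVec (flow (l y.1)) y.2 i := by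
    filter_upwards [(hΨc i).eventually_evalSeries_slice,
      (continuous_fst.tendsto (0 : (Fin q → ℂ) × (Fin m ⊕ Unit → ℂ))).eventually hslice,
      (continuous_fst.tendsto (0 : (Fin q → ℂ) × (Fin m ⊕ Unit → ℂ))).eventually hΨ]
      with y hy hy1 hy2
    rw [← hy, hy2 i, show (fun k => sliceSeries (F k) y.1) = fun k => (l y.1 k).1 from funext hy1]
    rfl
  refine AnalyticAt.congr (AnalyticAt.fun_comp (g := evalSeries (Ψ i)) ?_
    (analyticAt_sumElim 0)) hval
  rw [Prod.fst_zero, Prod.snd_zero, sumElim_zero_zero]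
  exact (hΨc i).analyticAt

/-! ### Polarization of a multilinear map at a base point -/

section Polarization

variable {E F : Type*} [AddCommGroup E] [Module ℂ E] [AddCommGroup F] [Module ℂ F] {n : ℕ}

/-- The symmetric `p`-linear form whose diagonal is the part of degree `p` in `h` of the
expansion of `W (X + h, …, X + h)`. -/
def polarForm (W : MultilinearMap ℂ (fun _ : Fin n => E) F) (X : E) (p : ℕ) :
    MultilinearMap ℂ (fun _ : Fin p => E) F :=
  (p.factorial : ℂ)⁻¹ • ∑ τ : Equiv.Perm (Fin p), ∑ s : {s : Finset (Fin n) // s.card = p},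
    (W.restr s.1 s.2 X).domDomCongr τ

theorem polarForm_apply (W : MultilinearMap ℂ (fun _ : Fin n => E) F) (X : E) (p : ℕ)
    (v : Fin p → E) : polarForm W X p v = (p.factorial : ℂ)⁻¹ •
      ∑ τ : Equiv.Perm (Fin p), ∑ s : {s : Finset (Fin n) // s.card = p},
        W.restr s.1 s.2 X fun i => v (τ i) := by
  simp [polarForm]

theorem polarForm_symm (W : MultilinearMap ℂ (fun _ : Fin n => E) F) (X : E) (p : ℕ)
    (τ : Equiv.Perm (Fin p)) (v : Fin p → E) :
    polarForm W X p (fun i => v (τ i)) = polarForm W X p v := by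
  rw [polarForm_apply, polarForm_apply]
  congr 1
  exact Fintype.sum_equiv (Equiv.mulLeft τ) _ _ fun ρ => rfl

/-- On the diagonal all permutations contribute equally, which cancels the factor `1 / p!`. -/
theorem polarForm_diag (W : MultilinearMap ℂ (fun _ : Fin n => E) F) (X h : E) (p : ℕ) :
    polarForm W X p (fun _ => h) = ∑ s : Finset (Fin n) with s.card = p,
      W (s.piecewise (fun _ => h) fun _ => X) := by
  have h1 : ∀ s : {s : Finset (Fin n) // s.card = p}, W.restr s.1 s.2 X (fun _ => h) =
      W (s.1.piecewise (fun _ => h) fun _ => X) := by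
    intro s
    refine congrArg W (funext fun j => ?_)
    by_cases hj : j ∈ s.1 <;> simp [hj]
  rw [polarForm_apply]
  simp_rw [h1]
  rw [Finset.sum_const, Finset.card_univ, Fintype.card_perm, Fintype.card_fin,
    ← Nat.cast_smul_eq_nsmul ℂ, smul_smul, inv_mul_cancel₀ (by
      exact_mod_cast p.factorial_ne_zero), one_smul]
  exact (Finset.sum_subtype _ (by simp) fun s : Finset (Fin n) =>
    W (s.piecewise (fun _ => h) fun _ => X)).symm

/-- Multilinear expansion of `W (X + h, …, X + h)` is a sum over the set of slots that receive `h`;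
the partial sum removes the sets with at most `N` elements. In particular nothing is left when `n ≤
N`. -/
theorem sub_sum_polarForm (W : MultilinearMap ℂ (fun _ : Fin n => E) F) (X h : E) (N : ℕ) :
    W (fun _ => X + h) - ∑ p ∈ Finset.range (N + 1), polarForm W X p (fun _ => h) =
      ∑ s : Finset (Fin n) with N < s.card, W (s.piecewise (fun _ => h) fun _ => X) := by
  have h1 : W (fun _ => X + h) = ∑ s : Finset (Fin n), W (s.piecewise (fun _ => h) fun _ => X) := by
    rw [← W.map_add_univ]
    exact congrArg W (funext fun _ => add_comm _ _)
  have h2 : ∑ p ∈ Finset.range (N + 1), polarForm W X p (fun _ => h) =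
      ∑ s : Finset (Fin n) with s.card ≤ N, W (s.piecewise (fun _ => h) fun _ => X) := by
    simp_rw [polarForm_diag]
    rw [← Finset.sum_fiberwise_of_maps_to (s := Finset.univ.filter fun s : Finset (Fin n) =>
      s.card ≤ N) (t := Finset.range (N + 1)) (g := fun s => s.card)
      (fun s hs => by simpa [Nat.lt_succ_iff] using hs)]
    refine Finset.sum_congr rfl fun p hp => Finset.sum_congr ?_ fun _ _ => rfl
    ext s
    have := Finset.mem_range.1 hp
    simp only [Finset.mem_filter, Finset.mem_univ, true_and]
    omega
  rw [h1, h2, ← Finset.sum_filter_add_sum_filter_not Finset.univ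
    (fun s : Finset (Fin n) => s.card ≤ N), add_sub_cancel_left]
  simp only [not_le]

variable {W : MultilinearMap ℂ (fun _ : Fin n => E) ℂ}

theorem norm_polarForm_le {X : E} {p : ℕ} {v : Fin p → E} {M : ℝ} (hM : 0 ≤ M)
    (h : ∀ (τ : Equiv.Perm (Fin p)) (s : Finset (Fin n)) (hs : s.card = p),
      ‖W.restr s hs X fun i => v (τ i)‖ ≤ M) : ‖polarForm W X p v‖ ≤ 2 ^ n * M := by
  have hp : (0 : ℝ) < p.factorial := by positivity
  rw [polarForm_apply, norm_smul, norm_inv, Complex.norm_natCast, inv_mul_le_iff₀ hp]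
  have hcard : ((Fintype.card {s : Finset (Fin n) // s.card = p} : ℕ) : ℝ) ≤ 2 ^ n := by
    have := Fintype.card_subtype_le fun s : Finset (Fin n) => s.card = p
    rw [Fintype.card_finset, Fintype.card_fin] at this
    exact_mod_cast this
  calc _ ≤ ∑ τ : Equiv.Perm (Fin p), ∑ s : {s : Finset (Fin n) // s.card = p}, M :=
        (norm_sum_le _ _).trans (Finset.sum_le_sum fun τ _ =>
          (norm_sum_le _ _).trans (Finset.sum_le_sum fun s _ => h τ s.1 s.2))
    _ = p.factorial * ((Fintype.card {s : Finset (Fin n) // s.card = p} : ℕ) * M) := by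
        simp [Fintype.card_perm]
    _ ≤ _ := by gcongr

variable {q : Seminorm ℂ E} {G B : ℝ} {X : E}

/-- Each term puts the `v i` in `p` slots and `X` in the others, and these others contribute at most
`B ^ n` because `B ≥ 1`. The `2 ^ n` bounds the number of subsets of slots, while the average over
permutations costs nothing. -/
theorem norm_polarForm_le_prod (hG : 0 ≤ G) (hW : ∀ Y, ‖W Y‖ ≤ G * ∏ k, q (Y k)) (hB : 1 ≤ B)
    (hX : q X ≤ B) {p : ℕ} (v : Fin p → E) :
    ‖polarForm W X p v‖ ≤ 2 ^ n * (G * B ^ n) * ∏ i, q (v i) := by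
  have hP : 0 ≤ ∏ i, q (v i) := Finset.prod_nonneg fun i _ => apply_nonneg q _
  rw [mul_assoc]
  refine norm_polarForm_le (by positivity) fun τ s hs => ?_
  have h1 : (∏ j : Fin n, q (if h : j ∈ s then v (τ ((s.orderIsoOfFin hs).symm ⟨j, h⟩)) else X)) ≤
      B ^ n * ∏ i, q (v i) := by
    have e : ∀ j : Fin n, q (if h : j ∈ s then v (τ ((s.orderIsoOfFin hs).symm ⟨j, h⟩)) else X) =
        if h : j ∈ s then q (v (τ ((s.orderIsoOfFin hs).symm ⟨j, h⟩))) else q X := by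
      intro j
      split_ifs <;> rfl
    simp_rw [e]
    rw [Fintype.prod_dite, mul_comm, Finset.prod_const]
    have e1 (inst : Fintype {a // a ∈ s}) :
        ∏ a : {a // a ∈ s}, q (v (τ ((s.orderIsoOfFin hs).symm ⟨a.1, a.2⟩))) = ∏ i, q (v i) :=
      Fintype.prod_equiv ((s.orderIsoOfFin hs).symm.toEquiv.trans τ) _ _ fun a => rfl
    refine mul_le_mul ?_ (e1 _).le
      (Finset.prod_nonneg fun _ _ => apply_nonneg q _) (by positivity)
    refine (pow_le_pow_left₀ (apply_nonneg q _) hX _).trans (pow_le_pow_right₀ hB ?_)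
    rw [Finset.card_univ]
    exact (Fintype.card_le_of_injective Subtype.val Subtype.val_injective).trans (by simp)
  calc ‖W.restr s hs X fun i => v (τ i)‖ ≤ G * ∏ j : Fin n,
        q (if h : j ∈ s then v (τ ((s.orderIsoOfFin hs).symm ⟨j, h⟩)) else X) := hW _
    _ ≤ _ := by
        rw [mul_assoc]
        gcongr

theorem norm_sub_sum_polarForm_le (hG : 0 ≤ G) (hW : ∀ Y, ‖W Y‖ ≤ G * ∏ k, q (Y k)) (hB : 1 ≤ B)
    (hX : q X ≤ B) {h : E} (hh : q h ≤ 1) (N : ℕ) :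
    ‖W (fun _ => X + h) - ∑ p ∈ Finset.range (N + 1), polarForm W X p (fun _ => h)‖ ≤
      if N < n then 2 ^ n * (G * B ^ n) else 0 := by
  rw [sub_sum_polarForm]
  split_ifs with hN
  · have h1 : ∀ s : Finset (Fin n), ‖W (s.piecewise (fun _ => h) fun _ => X)‖ ≤ G * B ^ n := by
      intro s
      refine (hW _).trans ?_
      gcongr
      refine (Finset.prod_le_prod (g := fun _ => B) (fun _ _ => apply_nonneg q _)
        fun k _ => ?_).trans (by simp)
      by_cases hk : k ∈ s
      · rw [Finset.piecewise_eq_of_mem _ _ _ hk]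
        exact hh.trans hB
      · rw [Finset.piecewise_eq_of_notMem _ _ _ hk]
        exact hX
    refine (norm_sum_le _ _).trans ((Finset.sum_le_sum fun s _ => h1 s).trans ?_)
    rw [Finset.sum_const, nsmul_eq_mul]
    have : (Finset.univ.filter fun s : Finset (Fin n) => N < s.card).card ≤ 2 ^ n := by
      refine (Finset.card_le_univ _).trans ?_
      rw [Fintype.card_finset, Fintype.card_fin]
    gcongr
    exact_mod_cast this
  · rw [Finset.filter_false_of_mem, Finset.sum_empty, norm_zero]
    intro s _ hs
    have := s.card_le_univ
    rw [Fintype.card_fin] at this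
    omega

end Polarization

/-! ### Continuity of bounded multilinear maps -/

section Continuity

variable {E F ι : Type*} [AddCommGroup E] [Module ℂ E] [TopologicalSpace E]
  [IsTopologicalAddGroup E] [AddCommGroup F] [Module ℂ F] [TopologicalSpace F]

/-- A multilinear map that is bounded by products of continuous seminorms is continuous. -/
theorem continuous_of_seminorm_le_prod {f : SeminormFamily ℂ F ι} (hf : WithSeminorms f) {p : ℕ}
    (T : MultilinearMap ℂ (fun _ : Fin p => E) F)
    (hT : ∀ i, ∃ q : Seminorm ℂ E, Continuous q ∧ ∃ C : ℝ, ∀ v, f i (T v) ≤ C * ∏ k, q (v k)) :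
    Continuous T := by
  rw [continuous_iff_continuousAt]
  intro v₀
  refine (hf.tendsto_nhds _ _).2 fun i ε hε => ?_
  obtain ⟨q, hq, C, hC⟩ := hT i
  -- In the expansion of `T (v₀ + (v - v₀))`, every term other than `T v₀` has a slot with `v - v₀`.
  -- Hence the bound `g` is continuous and vanishes at `v₀`.
  set g : (Fin p → E) → ℝ := fun v => ∑ s ∈ Finset.univ.erase (Finset.univ : Finset (Fin p)),
    C * ∏ k, q (s.piecewise v₀ (v - v₀) k) with hg
  have hgc : Continuous g := by
    refine continuous_finsetSum _ fun s _ => continuous_const.mul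
      (continuous_finsetProd _ fun k _ => ?_)
    by_cases hk : k ∈ s
    · simp only [Finset.piecewise_eq_of_mem _ _ _ hk]
      exact continuous_const
    · simp only [Finset.piecewise_eq_of_notMem _ _ _ hk]
      exact hq.comp ((continuous_apply k).sub continuous_const)
  have hg0 : g v₀ = 0 := by
    refine Finset.sum_eq_zero fun s hs => ?_
    obtain ⟨k, hk⟩ : ∃ k, k ∉ s := by
      by_contra! hall
      exact (Finset.mem_erase.1 hs).1 (Finset.eq_univ_iff_forall.2 hall)
    rw [Finset.prod_eq_zero (Finset.mem_univ k), mul_zero]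
    rw [Finset.piecewise_eq_of_notMem _ _ _ hk]
    simp
  have hgε : ∀ᶠ v in 𝓝 v₀, g v < ε := hgc.continuousAt.eventually_lt_const (by rwa [hg0])
  filter_upwards [hgε] with v hv
  refine lt_of_le_of_lt ?_ hv
  have h1 : T v - T v₀ = ∑ s ∈ Finset.univ.erase (Finset.univ : Finset (Fin p)),
      T (s.piecewise v₀ (v - v₀)) := by
    have := T.map_add_univ v₀ (v - v₀)
    rw [add_sub_cancel, ← Finset.add_sum_erase _ _ (Finset.mem_univ Finset.univ),
      Finset.piecewise_univ] at this
    rw [this, add_sub_cancel_left]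
  rw [h1]
  refine (Finset.le_sum_of_subadditive (f i) (map_zero (f i)).le (map_add_le_add _) _ _).trans ?_
  exact Finset.sum_le_sum fun s _ => hC _

end Continuity

/-! ### Factorial norms, and growth against factorial weights -/

section FactorialNorms

variable {σ : Type} [Fintype σ]

theorem factorialNorm_apply (k : ℕ) (f : HolGerm σ) : factorialNorm σ k f =
    ∑' l : σ →₀ ℕ, ‖taylorCoeff l f‖ * weight (1 / ((k : ℝ) + 1)) l := rfl

theorem one_le_prod_factorial (l : σ →₀ ℕ) : (1 : ℝ) ≤ ∏ i, ((l i).factorial : ℝ) := by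
  have : 1 ≤ ∏ i, (l i).factorial := Nat.one_le_iff_ne_zero.2
    (Finset.prod_ne_zero_iff.2 fun i _ => (l i).factorial_ne_zero)
  exact_mod_cast this

theorem prod_factorial_le (l : σ →₀ ℕ) {N : ℕ} (hl : l.degree ≤ N) :
    ∏ i, ((l i).factorial : ℝ) ≤ ((N : ℝ) + 1) ^ l.degree := by
  rw [Finsupp.degree_eq_sum, ← Finset.prod_pow_eq_pow_sum]
  refine Finset.prod_le_prod (fun _ _ => by positivity) fun i _ => ?_
  have h1 : ((l i).factorial : ℝ) ≤ (l i : ℝ) ^ l i := by exact_mod_cast (l i).factorial_le_pow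
  have h2 : l i ≤ N := (Finsupp.le_degree i l).trans hl
  refine h1.trans (pow_le_pow_left₀ (by positivity) ?_ _)
  have : (l i : ℝ) ≤ N := by exact_mod_cast h2
  linarith

/-- Multinomial coefficients grow at most geometrically: each added index costs a binomial
coefficient, bounded by a power of `2`. -/
theorem factorial_sum_le {ι : Type*} (t : Finset ι) (l : ι → ℕ) :
    ((∑ i ∈ t, l i).factorial : ℝ) ≤
      ((2 : ℝ) ^ t.card) ^ (∑ i ∈ t, l i) * ∏ i ∈ t, ((l i).factorial : ℝ) := by
  classical
  induction t using Finset.induction_on with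
  | empty => simp
  | insert a t ha ih =>
    rw [Finset.sum_insert ha, Finset.prod_insert ha, Finset.card_insert_of_notMem ha]
    set S := ∑ i ∈ t, l i
    have h1 : ((l a + S).factorial : ℝ) ≤ 2 ^ (l a + S) * ((l a).factorial * S.factorial) := by
      have h := Nat.add_choose_mul_factorial_mul_factorial (l a) S
      have h2 := Nat.choose_le_two_pow (l a + S) S
      rw [← h, mul_assoc]
      push_cast
      gcongr
      exact_mod_cast h2
    calc ((l a + S).factorial : ℝ) ≤ 2 ^ (l a + S) * ((l a).factorial *
          (((2 : ℝ) ^ t.card) ^ S * ∏ i ∈ t, ((l i).factorial : ℝ))) := h1.trans (by gcongr)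
      _ ≤ 2 ^ (l a + S) * ((l a).factorial *
          (((2 : ℝ) ^ t.card) ^ (l a + S) * ∏ i ∈ t, ((l i).factorial : ℝ))) := by
          gcongr
          · exact one_le_pow₀ one_le_two
          · omega
      _ = _ := by rw [pow_succ (2 : ℝ) t.card, mul_pow]; ring

/-- Up to a geometric factor, the `d`-th power of `d + 1` is at most `d!`, hence at most the
multi-index factorial. This is what compares `growth` with `weight`. -/
theorem pow_degree_le (l : σ →₀ ℕ) :
    ((l.degree : ℝ) + 1) ^ l.degree ≤
      (Real.exp 1 * 2 ^ Fintype.card σ) ^ (l.degree + 1) * ∏ i, ((l i).factorial : ℝ) := by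
  have h1 := Real.pow_div_factorial_le_exp ((l.degree : ℝ) + 1) (by positivity) l.degree
  rw [div_le_iff₀ (by positivity)] at h1
  have h2 := factorial_sum_le Finset.univ fun i => l i
  rw [← Finsupp.degree_eq_sum, Finset.card_univ] at h2
  have h3 : Real.exp ((l.degree : ℝ) + 1) = Real.exp 1 ^ (l.degree + 1) := by
    rw [← Real.exp_nat_mul]
    push_cast
    ring_nf
  refine h1.trans ?_
  rw [h3, mul_pow, mul_assoc]
  gcongr
  refine h2.trans ?_
  gcongr
  · exact one_le_pow₀ one_le_two
  · omega

/-- The growth, in the degree `N`, of the Taylor coefficients of flows. -/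
def growth (β : ℝ) (N : ℕ) : ℝ := (2 * Real.exp 1 * ((N : ℝ) + 1) ^ β) ^ N

theorem growth_nonneg (β : ℝ) (N : ℕ) : 0 ≤ growth β N := by
  unfold growth; positivity

theorem summable_growth_mul_weight {α β A : ℝ} (hβ : 0 ≤ β) (hαβ : β < α) (hA : 0 ≤ A) :
    Summable fun l : σ →₀ ℕ => A ^ l.degree * growth β l.degree * weight α l := by
  set D : ℝ := (Real.exp 1 * 2 ^ Fintype.card σ) ^ β
  have hD : 0 ≤ D := by positivity
  set Q : ℝ := A * (2 * Real.exp 1) * D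
  have hQ : 0 ≤ Q := by positivity
  -- After `pow_degree_le`, the terms are geometric with ratio `Q`, times a weight of the positive
  -- exponent `α - β`. Summability is then finiteness of the corresponding weighted sum for the
  -- geometric series, which is convergent.
  let f : MvPowerSeries σ ℂ := fun l => ((Q ^ l.degree : ℝ) : ℂ)
  have hf : ∀ l, ‖MvPowerSeries.coeff l f‖ = Q ^ l.degree := fun l => by
    change ‖((Q ^ l.degree : ℝ) : ℂ)‖ = _
    rw [Complex.norm_real, Real.norm_of_nonneg (by positivity)]
  have hc : IsConvergent f := hasRadius_of_coeff_le hQ (C := 1) fun l => by rw [hf, one_mul]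
  have hs := (summable_weight (sub_pos.2 hαβ) hc.germ).mul_left D
  refine Summable.of_nonneg_of_le (fun l => ?_) (fun l => ?_) hs
  · have := growth_nonneg β l.degree
    have := weight_nonneg α l
    positivity
  · set P : ℝ := ∏ i, ((l i).factorial : ℝ)
    have hP : 0 < P := zero_lt_one.trans_le (one_le_prod_factorial l)
    change A ^ l.degree * growth β l.degree * P ^ (-α) ≤
      D * (‖MvPowerSeries.coeff l f‖ * P ^ (-(α - β)))
    have h1 : (((l.degree : ℝ) + 1) ^ β) ^ l.degree ≤ D ^ (l.degree + 1) * P ^ β := by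
      have h := Real.rpow_le_rpow (by positivity) (pow_degree_le l) hβ
      rw [Real.mul_rpow (by positivity) hP.le, ← Real.rpow_natCast, ← Real.rpow_natCast,
        ← Real.rpow_mul (by positivity), ← Real.rpow_mul (by positivity), mul_comm _ β,
        mul_comm _ β, Real.rpow_mul (by positivity), Real.rpow_mul (by positivity),
        Real.rpow_natCast, Real.rpow_natCast] at h
      exact h
    have h2 : P ^ β * P ^ (-α) = P ^ (-(α - β)) := by
      rw [← Real.rpow_add hP]
      congr 1
      ring
    rw [hf, ← h2]
    unfold growth
    rw [mul_pow (2 * Real.exp 1)]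
    calc _ ≤ A ^ l.degree * ((2 * Real.exp 1) ^ l.degree * (D ^ (l.degree + 1) * P ^ β)) *
          P ^ (-α) := by gcongr
      _ = _ := by simp only [Q, mul_pow]; ring

/-- In degrees at most `N` one has `l! ≤ (N + 1) ^ |l|`, so the weight of `l` is at least the
`|l|`-th power of the radius. The estimate needs the truncation: the radius tends to `0` as `N`
grows. -/
theorem truncNorm_le_factorialNorm (k N : ℕ) (f : HolGerm σ) :
    truncNorm N (ENNReal.ofReal (((N : ℝ) + 1) ^ (-(1 / ((k : ℝ) + 1))))) f.1 ≤
      ENNReal.ofReal (factorialNorm σ k f) := by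
  have hk : (0 : ℝ) < 1 / ((k : ℝ) + 1) := by positivity
  rw [factorialNorm_apply, ENNReal.ofReal_tsum_of_nonneg
    (fun l => mul_nonneg (norm_nonneg _) (weight_nonneg _ _)) (summable_weight hk f)]
  refine ENNReal.tsum_le_tsum fun l => ?_
  split_ifs with hl
  · have hl' : l.degree ≤ N := by exact_mod_cast hl
    rw [ENNReal.ofReal_mul (norm_nonneg _), ofReal_norm, ← ENNReal.ofReal_pow (by positivity)]
    refine mul_le_mul_right (ENNReal.ofReal_le_ofReal ?_) _
    unfold weight
    have h1 : 0 < ∏ i, ((l i).factorial : ℝ) := zero_lt_one.trans_le (one_le_prod_factorial l)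
    rw [← Real.rpow_natCast, ← Real.rpow_mul (by positivity), mul_comm,
      Real.rpow_mul (by positivity), Real.rpow_natCast]
    exact Real.rpow_le_rpow_of_nonpos h1 (prod_factorial_le l hl') (by linarith)
  · exact zero_le

theorem factorialNorm_mono {k K : ℕ} (h : k ≤ K) (f : HolGerm σ) :
    factorialNorm σ k f ≤ factorialNorm σ K f := by
  have hk : (0 : ℝ) < 1 / ((k : ℝ) + 1) := by positivity
  have hK : (0 : ℝ) < 1 / ((K : ℝ) + 1) := by positivity
  refine (summable_weight hk f).tsum_le_tsum (fun l => ?_) (summable_weight hK f)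
  refine mul_le_mul_of_nonneg_left ?_ (norm_nonneg _)
  refine Real.rpow_le_rpow_of_exponent_le (one_le_prod_factorial l) (neg_le_neg ?_)
  have : (k : ℝ) ≤ K := by exact_mod_cast h
  gcongr

variable {ι : Type} [Fintype ι]

/-- The sum of the factorial norms of the components. -/
def vecNorm (ι σ : Type) [Fintype ι] [Fintype σ] (k : ℕ) : Seminorm ℂ (ι → HolGerm σ) :=
  ∑ i, (factorialNorm σ k).comp (LinearMap.proj i)

theorem vecNorm_apply (k : ℕ) (v : ι → HolGerm σ) :
    vecNorm ι σ k v = ∑ i, factorialNorm σ k (v i) := by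
  simp [vecNorm]

theorem continuous_vecNorm (k : ℕ) : Continuous (vecNorm ι σ k) := by
  rw [show (vecNorm ι σ k : (ι → HolGerm σ) → ℝ) = fun v => ∑ i, factorialNorm σ k (v i) from
    funext (vecNorm_apply k)]
  exact continuous_finsetSum _ fun i _ =>
    (withSeminorms_factorialNorm.continuous_seminorm k).comp (continuous_apply i)

/-- A continuous seminorm is dominated by finitely many of the defining ones, and these increase
with the index, so the largest index suffices. -/
theorem exists_le_vecNorm (b : Seminorm ℂ (ι → HolGerm σ)) (hb : Continuous b) :
    ∃ (K : ℕ) (C : ℝ), 0 ≤ C ∧ ∀ v, b v ≤ C * vecNorm ι σ K v := by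
  obtain ⟨s, C, -, hC⟩ := Seminorm.bound_of_continuous
    (withSeminorms_pi fun _ : ι => withSeminorms_factorialNorm (σ := σ)) b hb
  refine ⟨s.sup fun p => p.2, C, C.2, fun v => (hC v).trans ?_⟩
  refine mul_le_mul_of_nonneg_left ?_ C.2
  refine Seminorm.finset_sup_apply_le (apply_nonneg _ _) fun p hp => ?_
  rw [vecNorm_apply]
  refine le_trans ?_ (Finset.single_le_sum (fun i _ => apply_nonneg (factorialNorm σ _) (v i))
    (Finset.mem_univ p.1))
  exact factorialNorm_mono (Finset.le_sup (f := fun p : (_ : ι) × ℕ => p.2) hp) (v p.1)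

end FactorialNorms

/-! ### Taylor coefficients of the flow as multilinear forms; ample boundedness -/

section Forms

variable {σ : Type} [Fintype σ]

variable (σ) in
/-- The family of series of a vector of germs. -/
def seriesMap : (σ → HolGerm σ) →ₗ[ℂ] σ → MvPowerSeries σ ℂ :=
  LinearMap.pi fun i =>
    LinearMap.comp (convergentSubmodule σ).subtype (LinearMap.proj (φ := fun _ => HolGerm σ) i)

/-- The coefficient of the flow at the multi-index `l`, as the diagonal of a multilinear form. -/
def coeffForm (i : σ) (l : σ ⊕ Unit →₀ ℕ) :
    MultilinearMap ℂ (fun _ : Fin (l (Sum.inr ())) => σ → HolGerm σ) ℂ :=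
  (((l (Sum.inr ())).factorial : ℂ)⁻¹ •
    (MvPowerSeries.coeff (l.comapDomain Sum.inl Sum.inl_injective.injOn)).compMultilinearMap
      (iterFieldDeriv (l (Sum.inr ())) (MvPowerSeries.X i))).compLinearMap fun _ => seriesMap σ

theorem norm_coeffForm (i : σ) (l : σ ⊕ Unit →₀ ℕ) (Y : Fin (l (Sum.inr ())) → σ → HolGerm σ) :
    ‖coeffForm i l Y‖ = ‖MvPowerSeries.coeff (l.comapDomain Sum.inl Sum.inl_injective.injOn)
      (iterFieldDeriv (l (Sum.inr ())) (MvPowerSeries.X i) fun k a => (Y k a).1)‖ /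
        (l (Sum.inr ())).factorial := by
  change ‖((l (Sum.inr ())).factorial : ℂ)⁻¹ * _‖ = _
  rw [norm_mul, norm_inv, Complex.norm_natCast, inv_mul_eq_div]
  rfl

theorem coeffForm_const (i : σ) (l : σ ⊕ Unit →₀ ℕ) (X : σ → HolGerm σ) :
    coeffForm i l (fun _ => X) = MvPowerSeries.coeff l (flowSeries (fun a => (X a).1) i) := by
  rw [coeff_flowSeries, ← iterFieldDeriv_const, div_eq_inv_mul]
  rfl

/-- The Cauchy estimate is applied with radius `s / 2`, where `s = (N + 1) ^ (-β)` and `N` is the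
total degree. Space degree plus number of derivations is exactly `N`, so the truncated norms at
radius `s` are controlled by `truncNorm_le_factorialNorm`. -/
theorem norm_coeffForm_le (i : σ) (l : σ ⊕ Unit →₀ ℕ) (k : ℕ)
    (Y : Fin (l (Sum.inr ())) → σ → HolGerm σ) :
    ‖coeffForm i l Y‖ ≤ growth (1 / ((k : ℝ) + 1)) l.degree * ∏ a, vecNorm σ σ k (Y a) := by
  set N := l.degree
  set β := 1 / ((k : ℝ) + 1)
  have hβ : 0 < β := by positivity
  set j := l.comapDomain Sum.inl Sum.inl_injective.injOn
  have hN : N = j.degree + l (Sum.inr ()) := degree_eq_add l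
  have hN1 : (1 : ℝ) ≤ (N : ℝ) + 1 := by simp
  set s : ℝ := ((N : ℝ) + 1) ^ (-β)
  have hs : 0 < s := by positivity
  have hs1 : s ≤ 1 := Real.rpow_le_one_of_one_le_of_nonpos hN1 (by linarith)
  have hsi : s⁻¹ = ((N : ℝ) + 1) ^ β := by
    rw [← Real.rpow_neg (by positivity), neg_neg]
  rw [norm_coeffForm]
  refine (norm_coeff_iterFieldDeriv_le j i _ (half_pos hs) (B := fun a => vecNorm σ σ k (Y a))
    (fun a => apply_nonneg _ _) fun a => ?_).trans ?_
  · rw [vecNorm_apply, ENNReal.ofReal_sum_of_nonneg fun i _ => apply_nonneg _ _,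
      mul_div_cancel₀ s two_ne_zero, ← hN]
    exact Finset.sum_le_sum fun i _ => truncNorm_le_factorialNorm k N (Y a i)
  · have hP : 0 ≤ ∏ a, vecNorm σ σ k (Y a) := Finset.prod_nonneg fun a _ => apply_nonneg _ _
    refine mul_le_mul_of_nonneg_right ?_ hP
    have he : 1 ≤ Real.exp 1 := Real.one_le_exp zero_le_one
    -- One number dominates the ratios of both the space degree and the time degree, so that their
    -- powers combine to `M ^ N`.
    set M := 2 * Real.exp 1 * ((N : ℝ) + 1) ^ β
    have h1 : 1 / (s / 2) ≤ M := by
      rw [one_div_div, div_eq_mul_inv, hsi]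
      have : 0 ≤ ((N : ℝ) + 1) ^ β := by positivity
      nlinarith
    have h2 : Real.exp 1 / (s / 2) = M := by
      rw [div_div_eq_mul_div, div_eq_mul_inv, hsi]
      ring
    rw [h2]
    calc (1 / (s / 2)) ^ j.degree * M ^ l (Sum.inr ()) * (2 * (s / 2))
        ≤ M ^ j.degree * M ^ l (Sum.inr ()) * 1 := by
          gcongr
          linarith
      _ = growth β N := by rw [growth, mul_one, ← pow_add, ← hN]

theorem taylorCoeff_flow {m : ℕ} (X : VF m) (i : Fin m) (l : Fin m ⊕ Unit →₀ ℕ) :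
    taylorCoeff l (flow X i) = coeffForm i l fun _ => X := (coeffForm_const i l X).symm

theorem amplyBounded_flow (m : ℕ) : AmplyBounded (flow (m := m)) := by
  intro X b hb
  obtain ⟨K, C, hC, hbC⟩ := exists_le_vecNorm b hb
  have hβ : (0 : ℝ) ≤ 1 / (((K + 1 : ℕ) : ℝ) + 1) := by positivity
  -- One index is lost between source and target: the field is measured with norm `K + 1` and the
  -- flow with norm `K`, so that the growth exponent is strictly below the weight exponent.
  have hαβ : 1 / (((K + 1 : ℕ) : ℝ) + 1) < 1 / ((K : ℝ) + 1) := by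
    push_cast
    gcongr
    linarith
  set q := vecNorm (Fin m) (Fin m) (K + 1)
  set B := q X + 1
  have hB : 1 ≤ B := by simp [B]
  have hs := summable_growth_mul_weight (σ := Fin m ⊕ Unit) hβ hαβ (zero_le_one.trans hB)
  have hW : ∀ᶠ h in 𝓝 (0 : VF m), q h < 1 := by
    have := (continuous_vecNorm (ι := Fin m) (σ := Fin m) (K + 1)).tendsto 0
    rw [map_zero] at this
    exact this.eventually_lt_const one_pos
  refine ⟨_, hW, C * ∑ _i : Fin m, ∑' l : Fin m ⊕ Unit →₀ ℕ, B ^ l.degree *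
    growth (1 / (((K + 1 : ℕ) : ℝ) + 1)) l.degree * weight (1 / ((K : ℝ) + 1)) l, fun h hh => ?_⟩
  refine (hbC _).trans ?_
  rw [vecNorm_apply]
  gcongr with i
  refine (summable_weight (by positivity) _).tsum_le_tsum (fun l => ?_) hs
  refine mul_le_mul_of_nonneg_right ?_ (weight_nonneg _ _)
  rw [taylorCoeff_flow]
  refine (norm_coeffForm_le i l (K + 1) _).trans ?_
  rw [Finset.prod_const, Finset.card_univ, Fintype.card_fin, mul_comm]
  refine mul_le_mul_of_nonneg_right ?_ (growth_nonneg _ _)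
  have h1 : q (X + h) ≤ B := (map_add_le_add q X h).trans (by
    have : q h < 1 := hh
    simp only [B]
    linarith)
  exact (pow_le_pow_left₀ (apply_nonneg _ _) h1 _).trans
    (pow_le_pow_right₀ hB (Finsupp.le_degree _ l))

end Forms

/-! ### The power series expansion of the flow mapping -/

section Analyticity

variable {m : ℕ}

/-- Needed for the terms of the expansion to be convergent germs at all: the factorial estimate
grows faster than geometrically and cannot give this. The constants may depend on `X` and `v`, since
only finitely many convergent fields occur. -/
theorem exists_norm_polarForm_coeffForm_le (X : VF m) {p : ℕ} (v : Fin p → VF m) (i : Fin m) :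
    ∃ A ≥ 0, ∃ C : ℝ, ∀ l, ‖polarForm (coeffForm i l) X p v‖ ≤ C * A ^ l.degree := by
  -- The label `none` stands for the base field `X`, and `some i` for `v i`.
  obtain ⟨A, hA, C, h⟩ := exists_norm_coeff_iterFieldDeriv_le (κ := Option (Fin p))
    (X := fun k a => ((k.elim X v) a).1) fun k a => isConvergent_coe _
  have hC : 0 ≤ C := by
    have := h 0 0 i Fin.elim0
    simp only [map_zero, add_zero, pow_zero, mul_one] at this
    exact le_trans (by positivity) this
  refine ⟨2 * A, by positivity, C, fun l => ?_⟩
  set n := l (Sum.inr ())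
  have hn : n ≤ l.degree := Finsupp.le_degree _ l
  have key : ‖polarForm (coeffForm i l) X p v‖ ≤ 2 ^ n * (C * A ^ l.degree) := by
    refine norm_polarForm_le (by positivity) fun τ s hs => ?_
    have h1 : (coeffForm i l).restr s hs X (fun i => v (τ i)) = coeffForm i l fun j =>
        (if h : j ∈ s then some (τ ((s.orderIsoOfFin hs).symm ⟨j, h⟩)) else none).elim X v := by
      refine congrArg (coeffForm i l) (funext fun j => ?_)
      by_cases hj : j ∈ s <;> simp [hj]
    rw [h1, norm_coeffForm, degree_eq_add]
    exact h _ _ i _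
  refine key.trans ?_
  rw [mul_pow, mul_left_comm]
  gcongr
  norm_num

/-- The homogeneous terms of the expansion of the flow at `X`. -/
def flowTerm (X : VF m) (p : ℕ) : MultilinearMap ℂ (fun _ : Fin p => VF m) (FlowSpace m) where
  toFun v i := IsConvergent.germ (f := fun l => polarForm (coeffForm i l) X p v) (by
    obtain ⟨A, hA, C, h⟩ := exists_norm_polarForm_coeffForm_le X v i
    exact hasRadius_of_coeff_le hA h)
  map_update_add' v k x y := funext fun i => HolGerm.ext_series <| funext fun l =>
    (polarForm (coeffForm i l) X p).map_update_add v k x y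
  map_update_smul' v k c x := funext fun i => HolGerm.ext_series <| funext fun l =>
    (polarForm (coeffForm i l) X p).map_update_smul v k c x

theorem taylorCoeff_flowTerm (X : VF m) (p : ℕ) (v : Fin p → VF m) (i : Fin m)
    (l : Fin m ⊕ Unit →₀ ℕ) :
    taylorCoeff l (flowTerm X p v i) = polarForm (coeffForm i l) X p v := rfl

instance : IsTopologicalAddGroup (VF m) :=
  (withSeminorms_pi fun _ : Fin m =>
    withSeminorms_factorialNorm (σ := Fin m)).topologicalAddGroup

theorem two_pow_mul_growth_mul_pow_le {B β : ℝ} (hB : 1 ≤ B) (l : Fin m ⊕ Unit →₀ ℕ) :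
    2 ^ l (Sum.inr ()) * (growth β l.degree * B ^ l (Sum.inr ())) ≤
      (2 * B) ^ l.degree * growth β l.degree := by
  have hn : l (Sum.inr ()) ≤ l.degree := Finsupp.le_degree _ l
  have := growth_nonneg β l.degree
  calc _ = (2 * B) ^ l (Sum.inr ()) * growth β l.degree := by rw [mul_pow]; ring
    _ ≤ _ := by
        gcongr
        linarith

theorem continuous_flowTerm (X : VF m) (p : ℕ) : Continuous (flowTerm X p) := by
  refine continuous_of_seminorm_le_prod
    (withSeminorms_pi fun _ : Fin m => withSeminorms_factorialNorm (σ := Fin m ⊕ Unit))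
    (flowTerm X p) fun ⟨i, K⟩ => ?_
  have hβ : (0 : ℝ) ≤ 1 / (((K + 1 : ℕ) : ℝ) + 1) := by positivity
  have hαβ : 1 / (((K + 1 : ℕ) : ℝ) + 1) < 1 / ((K : ℝ) + 1) := by
    push_cast
    gcongr
    linarith
  set q := vecNorm (Fin m) (Fin m) (K + 1)
  set B := q X + 1
  have hqX : 0 ≤ q X := apply_nonneg _ _
  have hB : 1 ≤ B := by simp [B]
  have hs := summable_growth_mul_weight (σ := Fin m ⊕ Unit) hβ hαβ
    (A := 2 * B) (by positivity)
  refine ⟨q, continuous_vecNorm _, ∑' l : Fin m ⊕ Unit →₀ ℕ, (2 * B) ^ l.degree *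
    growth (1 / (((K + 1 : ℕ) : ℝ) + 1)) l.degree * weight (1 / ((K : ℝ) + 1)) l, fun v => ?_⟩
  rw [← tsum_mul_right]
  have hP : 0 ≤ ∏ k, q (v k) := Finset.prod_nonneg fun k _ => apply_nonneg _ _
  refine (summable_weight (by positivity) (flowTerm X p v i)).tsum_le_tsum (fun l => ?_)
    (hs.mul_right _)
  change ‖taylorCoeff l (flowTerm X p v i)‖ * _ ≤ _
  rw [taylorCoeff_flowTerm, mul_right_comm]
  refine mul_le_mul_of_nonneg_right ?_ (weight_nonneg _ _)
  refine (norm_polarForm_le_prod (growth_nonneg _ _) (norm_coeffForm_le i l (K + 1)) hB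
    (by simp [B, q]) v).trans ?_
  exact mul_le_mul_of_nonneg_right (two_pow_mul_growth_mul_pow_le hB l) hP

theorem analyticMap_flow (m : ℕ) : AnalyticMap (flow (m := m)) := by
  intro X
  refine ⟨fun p => ⟨flowTerm X p, continuous_flowTerm X p⟩, fun p τ v => ?_, fun b hb => ?_⟩
  · exact funext fun i => HolGerm.ext_series <| funext fun l => polarForm_symm _ X p τ v
  obtain ⟨K, C, hC, hbC⟩ := exists_le_vecNorm b hb
  have hβ : (0 : ℝ) ≤ 1 / (((K + 1 : ℕ) : ℝ) + 1) := by positivity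
  have hαβ : 1 / (((K + 1 : ℕ) : ℝ) + 1) < 1 / ((K : ℝ) + 1) := by
    push_cast
    gcongr
    linarith
  set q := vecNorm (Fin m) (Fin m) (K + 1)
  set B := q X + 1
  have hqX : 0 ≤ q X := apply_nonneg _ _
  have hB : 1 ≤ B := by simp [B]
  have hs := summable_growth_mul_weight (σ := Fin m ⊕ Unit) hβ hαβ
    (A := 2 * B) (by positivity)
  set S : (Fin m ⊕ Unit →₀ ℕ) → ℝ := fun l => (2 * B) ^ l.degree *
    growth (1 / (((K + 1 : ℕ) : ℝ) + 1)) l.degree * weight (1 / ((K : ℝ) + 1)) l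
  have hS0 : ∀ l, 0 ≤ S l := fun l => mul_nonneg
    (mul_nonneg (by positivity) (growth_nonneg _ _)) (weight_nonneg _ _)
  -- The coefficient form at `l` is linear in `l (Sum.inr ())` slots, so its remainder vanishes once
  -- `N` reaches this number. The total degree is at least as large, so cutting off by degree still
  -- gives an upper bound.
  set u : ℕ → (Fin m ⊕ Unit →₀ ℕ) → ℝ := fun N l => if N < l.degree then S l else 0
  have hu0 : ∀ N l, 0 ≤ u N l := fun N l => by
    simp only [u]
    split_ifs
    exacts [hS0 l, le_rfl]
  have huS : ∀ N l, u N l ≤ S l := fun N l => by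
    simp only [u]
    split_ifs
    exacts [le_rfl, hS0 l]
  have husum : ∀ N, Summable (u N) := fun N => Summable.of_nonneg_of_le (hu0 N) (huS N) hs
  -- The bound does not involve `h`, so its convergence to `0` by dominated convergence is what
  -- makes the convergence of the expansion uniform on the neighbourhood.
  have hlim : Tendsto (fun N => C * ∑ _i : Fin m, ∑' l, u N l) atTop (𝓝 0) := by
    have h1 : Tendsto (fun N => ∑' l, u N l) atTop (𝓝 (∑' _l : Fin m ⊕ Unit →₀ ℕ, (0 : ℝ))) := by
      refine tendsto_tsum_of_dominated_convergence hs (fun l => ?_)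
        (Eventually.of_forall fun N l => ?_)
      · refine tendsto_const_nhds.congr' ?_
        filter_upwards [eventually_ge_atTop l.degree] with N hN
        simp only [u]
        rw [if_neg (not_lt.2 hN)]
      · rw [Real.norm_of_nonneg (hu0 N l)]
        exact huS N l
    rw [tsum_zero] at h1
    have h2 := (tendsto_finsetSum (Finset.univ : Finset (Fin m)) fun _ _ => h1).const_mul C
    simpa using h2
  have hW : ∀ᶠ h in 𝓝 (0 : VF m), q h < 1 := by
    have := (continuous_vecNorm (ι := Fin m) (σ := Fin m) (K + 1)).tendsto 0
    rw [map_zero] at this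
    exact this.eventually_lt_const one_pos
  refine ⟨_, hW, Metric.tendstoUniformlyOn_iff.2 fun ε hε => ?_⟩
  filter_upwards [hlim.eventually_lt_const hε] with N hN h hh
  rw [dist_zero_left, Real.norm_of_nonneg (apply_nonneg _ _)]
  refine lt_of_le_of_lt ((hbC _).trans ?_) hN
  rw [vecNorm_apply]
  gcongr with i
  refine (summable_weight (by positivity) _).tsum_le_tsum (fun l => ?_) (husum N)
  have hcoef : taylorCoeff l ((flow (X + h) - ∑ p ∈ Finset.range (N + 1),
      flowTerm X p fun _ => h) i) = coeffForm i l (fun _ => X + h) -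
        ∑ p ∈ Finset.range (N + 1), polarForm (coeffForm i l) X p fun _ => h := by
    rw [Pi.sub_apply, map_sub, taylorCoeff_flow, Finset.sum_apply, map_sum]
    rfl
  change ‖taylorCoeff l ((flow (X + h) - ∑ p ∈ Finset.range (N + 1),
    flowTerm X p fun _ => h) i)‖ * _ ≤ _
  rw [hcoef]
  have hle := norm_sub_sum_polarForm_le (growth_nonneg _ _) (norm_coeffForm_le i l (K + 1)) hB
    (X := X) (by simp [B, q]) (h := h) (le_of_lt hh) N
  have hn : l (Sum.inr ()) ≤ l.degree := Finsupp.le_degree _ l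
  by_cases hNn : N < l (Sum.inr ())
  · rw [if_pos hNn] at hle
    simp only [u]
    rw [if_pos (hNn.trans_le hn)]
    exact mul_le_mul_of_nonneg_right (hle.trans (two_pow_mul_growth_mul_pow_le hB l))
      (weight_nonneg _ _)
  · rw [if_neg hNn] at hle
    refine le_trans (mul_nonpos_of_nonpos_of_nonneg hle (weight_nonneg _ _)) (hu0 N l)

end Analyticity

end FlowGerm

end

theorem theoremC (m : ℕ) :
    (∀ X : FlowGerm.VF m, ∃! φ : FlowGerm.FlowSpace m, FlowGerm.IsFlowGerm X φ) ∧
    ∀ Φ : FlowGerm.VF m → FlowGerm.FlowSpace m, (∀ X, FlowGerm.IsFlowGerm X (Φ X)) →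
      FlowGerm.StronglyAnalytic Φ ∧ FlowGerm.AnalyticMap Φ := by
  refine ⟨fun X => ⟨FlowGerm.flow X, FlowGerm.isFlowGerm_flow X, fun φ hφ => hφ.eq_flow⟩,
    fun Φ hΦ => ?_⟩
  -- Uniqueness of the flow reduces every such `Φ` to the Lie series.
  obtain rfl : Φ = FlowGerm.flow := funext fun X => (hΦ X).eq_flow
  exact ⟨⟨FlowGerm.amplyBounded_flow m, FlowGerm.quasiStronglyAnalytic_flow m⟩,
    FlowGerm.analyticMap_flow m⟩
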